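/- Let $C_n$ denote the cycle with vertices $1,\dots,n$. A drawing of $C_n$ is a crossing-free straight-line drawing in $\mathbb{R}^2$; equivalently, for $n\ge 3$, an assignment of points to the vertices that makes $C_n$ a simple closed polygon. Two drawings $\Gamma$ and $\Gamma'$ of $C_n$ in the same rotational direction (both clockwise or both counterclockwise) are called shifted versions of each other if they are distinct as mappings, the closed curves realizing them are identical, and the sets of points representing the vertices are the same (so that, for some $o\in\{1,\dots,n-1\}$, vertex $i$ in $\Gamma$ lies where vertex $i+o$ (modulo $n$) lies in $\Gamma'$, for every $i$). A finite set $P\subset\mathbb{R}^2$ of obstacles is compatible with $\Gamma$ and $\Gamma'$ if $\Gamma$ can be continuously deformed into $\Gamma'$, as a drawing with labelled vertices, such that at all times the edges are pairwise noncrossing (but not necessarily straight-line) and the drawing contains no point of $P$. The set $P$ blocks $\Gamma$ and $\Gamma'$ if there is no such continuous deformation in which, moreover, the edges are straight-line segments at all times (that is, no planar morph from $\Gamma$ to $\Gamma'$ that avoids $P$). Let $n\ge 6$ be an even integer. Then there exists a drawing $\Gamma$ of $C_n$ such that, for every shifted version $\Gamma'$ of $\Gamma$, there is a set of seven obstacles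 that is compatible with $\Gamma$ and $\Gamma'$ and blocks $\Gamma$ and $\Gamma'$. -/

import Mathlib

open scoped unitInterval

noncomputable section

/-- The Euclidean plane. -/
abbrev Plane : Type := EuclideanSpace ℝ (Fin 2)

/-- Vertices placed by `pos` and edges drawn as the point sets `E u v` do not cross: distinct
vertices have distinct positions, an edge contains no vertex except its two ends, and two distinct
edges meet at most in common end vertices. -/
def NonCrossing {V : Type*} (G : SimpleGraph V) (pos : V → Plane) (E : V → V → Set Plane) :
    Prop :=
  Function.Injective pos ∧
  (∀ u v w, G.Adj u v → pos w ∈ E u v → w = u ∨ w = v) ∧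
  (∀ u v x y, G.Adj u v → G.Adj x y → s(u, v) ≠ s(x, y) →
    E u v ∩ E x y ⊆ pos '' ({u, v} ∩ {x, y}))

/-- The set of all points covered by the vertices and the edges. -/
def pointSet {V : Type*} (G : SimpleGraph V) (pos : V → Plane) (E : V → V → Set Plane) :
    Set Plane :=
  Set.range pos ∪ {p | ∃ u v, G.Adj u v ∧ p ∈ E u v}

/-- `Γ` is a (crossing-free, straight-line) drawing of `G` in the plane. -/
def IsDrawing {V : Type*} (G : SimpleGraph V) (Γ : V → Plane) : Prop :=
  NonCrossing G Γ (fun u v => segment ℝ (Γ u) (Γ v))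

/-- The set of points covered by the straight-line drawing `Γ`. -/
def drawnSet {V : Type*} (G : SimpleGraph V) (Γ : V → Plane) : Set Plane :=
  pointSet G Γ (fun u v => segment ℝ (Γ u) (Γ v))

/-- There is a planar morph from `Γ₁` to `Γ₂` that avoids `P`: the vertices move continuously, and
at all times the straight-line drawing is crossing-free and contains no point of `P`. -/
def ExistsAvoidingMorph {V : Type*} (G : SimpleGraph V) (Γ₁ Γ₂ : V → Plane) (P : Set Plane) :
    Prop :=
  ∃ H : Path Γ₁ Γ₂, ∀ t : I, IsDrawing G (H t) ∧ Disjoint (drawnSet G (H t)) P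

/-- The obstacles `P` block `Γ₁` and `Γ₂`. -/
def Blocks {V : Type*} (G : SimpleGraph V) (Γ₁ Γ₂ : V → Plane) (P : Set Plane) : Prop :=
  ¬ ExistsAvoidingMorph G Γ₁ Γ₂ P

/-- A crossing-free drawing of `G` whose edges need not be straight: the edge `uv` is the simple
arc `c u v`, parametrized from `u` to `v`, and `c v u` is the same arc traversed backwards. -/
def IsCurvedDrawing {V : Type*} (G : SimpleGraph V) (pos : V → Plane) (c : V → V → I → Plane) :
    Prop :=
  NonCrossing G pos (fun u v => Set.range (c u v)) ∧
  ∀ u v, G.Adj u v →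
    Continuous (c u v) ∧ Function.Injective (c u v) ∧
    c u v 0 = pos u ∧ c u v 1 = pos v ∧ ∀ s : I, c v u s = c u v (unitInterval.symm s)

/-- The straight-line edge `uv` of the drawing `Γ`, parametrized from `u` to `v`. -/
def straightEdge {V : Type*} (Γ : V → Plane) (u v : V) (s : I) : Plane :=
  AffineMap.lineMap (Γ u) (Γ v) (s : ℝ)

/-- `P` is compatible with `Γ₁` and `Γ₂`: there is a continuous deformation of the straight-line
drawing `Γ₁` into the straight-line drawing `Γ₂` that at all times is a crossing-free drawing, with
not necessarily straight edges, containing no point of `P`. -/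
def Compatible {V : Type*} (G : SimpleGraph V) (Γ₁ Γ₂ : V → Plane) (P : Set Plane) : Prop :=
  ∃ (pos : I → V → Plane) (c : I → V → V → I → Plane),
    (∀ v, Continuous (fun t => pos t v)) ∧
    (∀ u v, G.Adj u v → Continuous (fun ts : I × I => c ts.1 u v ts.2)) ∧
    (∀ t, IsCurvedDrawing G (pos t) (c t)) ∧
    (∀ t, Disjoint (pointSet G (pos t) (fun u v => Set.range (c t u v))) P) ∧
    pos 0 = Γ₁ ∧ (∀ u v, G.Adj u v → c 0 u v = straightEdge Γ₁ u v) ∧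
    pos 1 = Γ₂ ∧ (∀ u v, G.Adj u v → c 1 u v = straightEdge Γ₂ u v)

/-- The signed area of the closed polygon with vertices `Γ 0, Γ 1, …, Γ (n - 1)`, in this order;
for a simple polygon it is positive or negative according as the order is counterclockwise or
clockwise. (`finRotate n` is the cyclic successor.) -/
def signedArea {n : ℕ} (Γ : Fin n → Plane) : ℝ :=
  (∑ i, (Γ i 0 * Γ (finRotate n i) 1 - Γ (finRotate n i) 0 * Γ i 1)) / 2

/-- `Γ'` is a shifted version of `Γ`: both are drawings of the same plane cycle (that is, both run
through the vertices in the same rotational direction), they are distinct as mappings, the closed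
curves realizing them are identical, and the sets of points representing vertices are equal. -/
def IsShiftedVersion {n : ℕ} (Γ Γ' : Fin n → Plane) : Prop :=
  IsDrawing (SimpleGraph.cycleGraph n) Γ ∧ IsDrawing (SimpleGraph.cycleGraph n) Γ' ∧
  SignType.sign (signedArea Γ) = SignType.sign (signedArea Γ') ∧
  Γ ≠ Γ' ∧
  drawnSet (SimpleGraph.cycleGraph n) Γ = drawnSet (SimpleGraph.cycleGraph n) Γ' ∧
  Set.range Γ = Set.range Γ'

end

/-! The drawing is a double spiral around the origin in which every edge joins a point above the
horizontal axis to a point below it. Three obstacles on the axis suffice for blocking; the other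
four lie above the whole spiral and only bring the number to seven. The same seven obstacles serve
for every shift.

Blocking (`sides_preserved`): at every vertex, some obstacle on the axis separates the crossings of
the two incident edges with the axis. If a vertex reached the axis during a morph, these two edges
would force it to lie both left and right of that obstacle. Hence no vertex ever changes sides,
every edge keeps crossing the axis, and no edge ever changes the side on which it passes an
obstacle. One obstacle has the outermost edge on one side and all other edges on the other
(`spiralOffset_third_pos`, `spiralOffset_third_neg`), so a shift reached by a morph must map the
outermost edge to itself. It cannot exchange the two ends, as these lie on different sides of the
axis; so it is trivial (`blocks_spiralDrawing`).

Compatibility (`compatible_shift`): with curved edges allowed, the cycle slides along its own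
polygon, covering the same point set at all times, so obstacles off the drawing are never met.

A shifted version is given only through equal point sets and equal vertex sets. A connectedness
argument shows that it has the same edges, so it arises by a rotation or a reflection of the cycle;
the sign of the area excludes reflections (`IsShiftedVersion.exists_shift`). -/

/-! ### Crossings with the axis and what a morph preserves. -/

/-- For points `p`, `q` on opposite sides of the horizontal axis, with side signs `a`, `b`, a
positive multiple of `x - c`, where `x` is the abscissa in which the segment `pq` crosses the axis. -/
def crossOffset (a b : ℝ) (p q : Plane) (c : ℝ) : ℝ :=
  (p 0 - c) * (b * q 1) + (q 0 - c) * (a * p 1)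

lemma crossOffset_comm (a b : ℝ) (p q : Plane) (c : ℝ) :
    crossOffset a b p q c = crossOffset b a q p c := by
  unfold crossOffset; ring

lemma plane_ext {p q : Plane} (h0 : p 0 = q 0) (h1 : p 1 = q 1) : p = q := by
  ext i
  fin_cases i
  · exact h0
  · exact h1

lemma mem_segment_plane {p q r : Plane} :
    r ∈ segment ℝ p q ↔ ∃ α β : ℝ, 0 ≤ α ∧ 0 ≤ β ∧ α + β = 1 ∧
      r 0 = α * p 0 + β * q 0 ∧ r 1 = α * p 1 + β * q 1 := by
  constructor
  · rintro ⟨α, β, hα, hβ, h, rfl⟩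
    exact ⟨α, β, hα, hβ, h, by simp, by simp⟩
  · rintro ⟨α, β, hα, hβ, h, h0, h1⟩
    exact ⟨α, β, hα, hβ, h, plane_ext (by simp [h0]) (by simp [h1])⟩

lemma crossOffset_ne_zero {a b : ℝ} (hab : b = -a) {p q : Plane}
    (hp : 0 < a * p 1) (hq : 0 < b * q 1) {c : ℝ} (h : !₂[c, 0] ∉ segment ℝ p q) :
    crossOffset a b p q c ≠ 0 := by
  intro h0
  apply h
  unfold crossOffset at h0
  have hs : 0 < a * p 1 + b * q 1 := by linarith
  refine mem_segment_plane.2 ⟨b * q 1 / (a * p 1 + b * q 1), a * p 1 / (a * p 1 + b * q 1),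
    by positivity, by positivity, by field_simp; ring, ?_, ?_⟩
  · simp only [Matrix.cons_val_zero]
    field_simp
    linarith
  · simp only [Matrix.cons_val_one]
    field_simp
    subst hab
    simp

lemma crossOffset_eq_zero_of_mem {a b : ℝ} (hab : b = -a) {p q : Plane}
    (hp : 0 < a * p 1) (hq : 0 < b * q 1) {c : ℝ} (h : !₂[c, 0] ∈ segment ℝ p q) :
    crossOffset a b p q c = 0 := by
  obtain ⟨α, β, hα, hβ, h, h0, h1⟩ := mem_segment_plane.1 h
  simp only [Matrix.cons_val_zero, Matrix.cons_val_one] at h0 h1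
  have hs : 0 < a * p 1 + b * q 1 := by linarith
  subst hab
  have e1 : α * (a * p 1) = β * (-a * q 1) := by linear_combination -a * h1
  have hα' : α * (a * p 1 + -a * q 1) = -a * q 1 := by
    linear_combination e1 + (-a * q 1) * h
  have hβ' : β * (a * p 1 + -a * q 1) = a * p 1 := by
    linear_combination -e1 + (a * p 1) * h
  unfold crossOffset
  linear_combination (-(a * p 1 + -a * q 1)) * h0 - p 0 * hα' - q 0 * hβ'

lemma segment_subset_drawnSet {V : Type*} {G : SimpleGraph V} (Γ : V → Plane) {u v : V}
    (h : G.Adj u v) : segment ℝ (Γ u) (Γ v) ⊆ drawnSet G Γ := fun _ hp => Or.inr ⟨u, v, h, hp⟩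

/-- A degenerate configuration: `w` has reached the axis, and the neighbour `u` has not changed
sides. If the segment `uw` avoids `(c, 0)`, then the abscissa of `w` lies weakly on the side of `c` on which
the edge was crossing the axis. -/
lemma mul_pos_of_on_axis {a b L : ℝ} {p q : Plane} {c : ℝ} (hL : L ≠ 0)
    (hp : 0 ≤ a * p 1) (ha : a ≠ 0) (hq : q 1 = 0) (h : !₂[c, 0] ∉ segment ℝ p q)
    (hW : 0 ≤ L * crossOffset a b p q c)
    (hmax : 0 ≤ L * (p 0 - c) ∨ 0 ≤ L * (q 0 - c)) : 0 < L * (q 0 - c) := by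
  have hqc : q 0 - c ≠ 0 := by
    intro h0
    apply h
    have : q = !₂[c, 0] := plane_ext (by simp; linarith) (by simp [hq])
    rw [← this]
    exact right_mem_segment ℝ p q
  rcases hp.lt_or_eq with hp | hp
  -- With `q` on the axis and `p` off it, the edge crosses the axis in `q` itself.
  · have e : L * crossOffset a b p q c = (L * (q 0 - c)) * (a * p 1) := by
      unfold crossOffset; rw [hq]; ring
    rw [e] at hW
    exact lt_of_le_of_ne (nonneg_of_mul_nonneg_left hW hp) (mul_ne_zero hL hqc).symm
  -- Both ends are on the axis, so the offset vanishes and carries no information. By `hmax`, if `q`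
  -- were on the wrong side of `c`, then `p` would be weakly on the right side, and the segment
  -- would contain `(c, 0)`.
  · have hp0 : p 1 = 0 := by
      rcases mul_eq_zero.1 hp.symm with h | h
      · exact absurd h ha
      · exact h
    by_contra hneg
    have hneg' : L * (q 0 - c) < 0 := lt_of_le_of_ne (not_lt.1 hneg) (mul_ne_zero hL hqc)
    have hpos : 0 ≤ L * (p 0 - c) := hmax.resolve_right (not_le.2 hneg')
    apply h
    set A := L * (p 0 - c)
    set B := -(L * (q 0 - c)) with hB
    have hBpos : 0 < B := by rw [hB]; linarith
    have hs : 0 < A + B := by linarith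
    refine mem_segment_plane.2 ⟨B / (A + B), A / (A + B), by positivity, by positivity,
      by field_simp; ring, ?_, ?_⟩
    · simp only [Matrix.cons_val_zero]
      field_simp
      have : L * (c * (A + B) - (B * p 0 + A * q 0)) = 0 := by simp only [A, B]; ring
      rcases mul_eq_zero.1 this with h | h
      · exact absurd h hL
      · linarith
    · simp [hp0, hq]

/-- If all edges of `Γ` cross the horizontal axis, and at every vertex some two incident edges are
separated on the axis by an obstacle, then a morph avoiding the obstacles on the axis preserves the
sides of the vertices and the sides on which the edges pass the obstacles. -/
theorem sides_preserved {V : Type*} [Finite V] {G : SimpleGraph V} {Γ Γ' : V → Plane}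
    {P : Set Plane} (s : V → ℝ) (C : Set ℝ) (hC : C.Finite) (hCP : ∀ c ∈ C, !₂[c, 0] ∈ P)
    (hs : ∀ u v, G.Adj u v → s v = -s u) (hside : ∀ v, 0 < s v * Γ v 1)
    (hsep : ∀ w, ∃ u v, ∃ c ∈ C, G.Adj u w ∧ G.Adj v w ∧
      crossOffset (s u) (s w) (Γ u) (Γ w) c * crossOffset (s v) (s w) (Γ v) (Γ w) c < 0)
    (H : ExistsAvoidingMorph G Γ Γ' P) :
    (∀ v, 0 < s v * Γ' v 1) ∧ ∀ u v, G.Adj u v → ∀ c ∈ C,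
      0 < crossOffset (s u) (s v) (Γ u) (Γ v) c * crossOffset (s u) (s v) (Γ' u) (Γ' v) c := by
  classical
  obtain ⟨H, hH⟩ := H
  set L : V → V → ℝ → ℝ := fun u v c => crossOffset (s u) (s v) (Γ u) (Γ v) c with hL
  have hs0 : ∀ v, s v ≠ 0 := fun v h => by simpa [h] using hside v
  have havoid : ∀ t, ∀ u v, G.Adj u v → ∀ c ∈ C, !₂[c, 0] ∉ segment ℝ (H t u) (H t v) := by
    intro t u v huv c hc hmem
    exact Set.disjoint_left.1 (hH t).2 (segment_subset_drawnSet _ huv hmem) (hCP c hc)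
  have hL0 : ∀ u v, G.Adj u v → ∀ c ∈ C, L u v c ≠ 0 := by
    intro u v huv c hc
    refine crossOffset_ne_zero (hs u v huv) (hside u) (hside v) ?_
    have := havoid 0 u v huv c hc
    rwa [H.source] at this
  -- The times with strict inequalities form an open set, those with weak ones a closed set. They
  -- turn out to be equal, so connectedness of the interval finishes the proof.
  let T : Set I := {t | (∀ v, 0 < s v * H t v 1) ∧ ∀ u v, G.Adj u v → ∀ c ∈ C,
      0 < L u v c * crossOffset (s u) (s v) (H t u) (H t v) c}
  -- The additional disjunction says that not both ends are strictly on the wrong side of `c`. It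
  -- survives limits and replaces the offset when both ends are on the axis.
  let T' : Set I := {t | (∀ v, 0 ≤ s v * H t v 1) ∧ ∀ u v, G.Adj u v → ∀ c ∈ C,
      0 ≤ L u v c * crossOffset (s u) (s v) (H t u) (H t v) c ∧
      (0 ≤ L u v c * (H t u 0 - c) ∨ 0 ≤ L u v c * (H t v 0 - c))}
  have hcont : ∀ v i, Continuous fun t : I => H t v i := fun v i => by
    have : Continuous fun t : I => H t v := (continuous_apply v).comp H.continuous
    fun_prop
  have hcontW : ∀ u v c, Continuous fun t : I =>
      L u v c * crossOffset (s u) (s v) (H t u) (H t v) c := fun u v c => by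
    unfold crossOffset
    have := hcont u; have := hcont v
    fun_prop
  have hTopen : IsOpen T := by
    simp only [T, Set.ofPred_and, Set.ofPred_forall]
    refine (isOpen_iInter_of_finite fun v => ?_).inter
      (isOpen_iInter_of_finite fun u => isOpen_iInter_of_finite fun v =>
        isOpen_iInter_of_finite fun _ => hC.isOpen_biInter fun c _ => ?_)
    · exact isOpen_lt continuous_const (continuous_const.mul (hcont v 1))
    · exact isOpen_lt continuous_const (hcontW u v c)
  have hTclosed : IsClosed T' := by
    simp only [T', Set.ofPred_and, Set.ofPred_forall, Set.ofPred_or]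
    refine (isClosed_iInter fun v => ?_).inter
      (isClosed_iInter fun u => isClosed_iInter fun v =>
        isClosed_iInter fun _ => isClosed_iInter fun c => isClosed_iInter fun _ => ?_)
    · exact isClosed_le continuous_const (continuous_const.mul (hcont v 1))
    · refine (isClosed_le continuous_const (hcontW u v c)).inter
        ((isClosed_le continuous_const ?_).union (isClosed_le continuous_const ?_))
      · exact continuous_const.mul ((hcont u 0).sub continuous_const)
      · exact continuous_const.mul ((hcont v 0).sub continuous_const)
  have hTT' : T = T' := by
    apply Set.Subset.antisymm
    · rintro t ⟨h1, h2⟩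
      refine ⟨fun v => (h1 v).le, fun u v huv c hc => ⟨(h2 u v huv c hc).le, ?_⟩⟩
      by_contra! hneg
      have := h2 u v huv c hc
      -- The offset is a combination of the two relative abscissae with positive weights, so they
      -- cannot both have the wrong sign.
      have e : L u v c * crossOffset (s u) (s v) (H t u) (H t v) c =
          L u v c * (H t u 0 - c) * (s v * H t v 1) + L u v c * (H t v 0 - c) * (s u * H t u 1) := by
        unfold crossOffset; ring
      have := mul_neg_of_neg_of_pos hneg.1 (h1 v)
      have := mul_neg_of_neg_of_pos hneg.2 (h1 u)
      linarith
    · rintro t ⟨h1, h2⟩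
      have hstrict : ∀ v, 0 < s v * H t v 1 := by
        intro w
        refine lt_of_le_of_ne (h1 w) fun h0 => ?_
        have hw : H t w 1 = 0 := by
          rcases mul_eq_zero.1 h0.symm with h | h
          · exact absurd h (hs0 w)
          · exact h
        obtain ⟨u, v, c, hc, hu, hv, huv⟩ := hsep w
        -- A vertex `w` on the axis lies on that side of `c` on which each of its edges passes; the
        -- two edges chosen by `hsep` pass on different sides.
        have key : ∀ u, G.Adj u w → 0 < L u w c * (H t w 0 - c) := fun u hu =>
          mul_pos_of_on_axis (hL0 u w hu c hc) (h1 u) (hs0 u) hw (havoid t u w hu c hc)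
            (h2 u w hu c hc).1 (h2 u w hu c hc).2
        have := mul_pos (key u hu) (key v hv)
        have e : L u w c * (H t w 0 - c) * (L v w c * (H t w 0 - c)) =
            (L u w c * L v w c) * (H t w 0 - c) ^ 2 := by ring
        rw [e] at this
        exact absurd (pos_of_mul_pos_left this (sq_nonneg _)) (not_lt.2 huv.le)
      refine ⟨hstrict, fun u v huv c hc => lt_of_le_of_ne (h2 u v huv c hc).1 (Ne.symm ?_)⟩
      exact mul_ne_zero (hL0 u v huv c hc)
        (crossOffset_ne_zero (hs u v huv) (hstrict u) (hstrict v) (havoid t u v huv c hc))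
  have huniv : T = Set.univ := by
    refine IsClopen.eq_univ ⟨hTT' ▸ hTclosed, hTopen⟩ ⟨0, ?_⟩
    simp only [T, Set.mem_ofPred_eq, H.source]
    exact ⟨hside, fun u v huv c hc => mul_self_pos.2 (hL0 u v huv c hc)⟩
  have h1 : (1 : I) ∈ T := huniv ▸ Set.mem_univ _
  simpa only [T, Set.mem_ofPred_eq, H.target] using h1

/-! ### Arithmetic of the cycle. -/

open scoped Fin.CommRing in
lemma Fin.intCast_eq_iff {n : ℕ} [NeZero n] (k l : ℤ) :
    ((k : Fin n) = l) ↔ ∃ j : ℤ, k - l = j * n := by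
  rw [CharP.intCast_eq_intCast (Fin n) n, Int.modEq_iff_dvd]
  constructor
  · rintro ⟨j, hj⟩; exact ⟨-j, by linear_combination -hj⟩
  · rintro ⟨j, hj⟩; exact ⟨-j, by linear_combination -hj⟩

lemma Fin.one_ne_zero_and_two_ne_zero {n : ℕ} [NeZero n] (h : 3 ≤ n) : (1 : Fin n) ≠ 0 ∧ (2 : Fin n) ≠ 0 := by
  constructor
  · rw [Ne, Fin.ext_iff, Fin.val_one', Fin.val_zero, Nat.mod_eq_of_lt (by omega)]; omega
  · rw [Ne, Fin.ext_iff, Fin.val_zero]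
    show ¬ (2 % n = 0)
    rw [Nat.mod_eq_of_lt (by omega)]; omega

lemma cycleGraph_adj_iff {n : ℕ} [NeZero n] (h : 3 ≤ n) {u v : Fin n} :
    (SimpleGraph.cycleGraph n).Adj u v ↔ v = u + 1 ∨ u = v + 1 := by
  obtain ⟨m, rfl⟩ : ∃ m, n = m + 1 := ⟨n - 1, by omega⟩
  have h1 := (Fin.one_ne_zero_and_two_ne_zero h).1
  rw [SimpleGraph.cycleGraph_eq_circulantGraph]
  simp only [SimpleGraph.circulantGraph_adj, Set.mem_singleton_iff]
  constructor
  · rintro ⟨_, h | h⟩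
    · right; rw [← h]; abel
    · left; rw [← h]; abel
  · rintro (h | h)
    · subst h
      refine ⟨?_, Or.inr (by abel)⟩
      intro h; apply h1; simpa using h
    · subst h
      refine ⟨?_, Or.inl (by abel)⟩
      intro h; apply h1; simpa using h

/-! ### Sliding a cycle along its own polygon. -/

section Polyline

open scoped Fin.CommRing

variable {n : ℕ} [NeZero n]

/-- The closed polygon through `Γ 0, Γ 1, …`, as an `n`-periodic curve. -/
noncomputable def polyline (Γ : Fin n → Plane) (x : ℝ) : Plane :=
  AffineMap.lineMap (Γ ((⌊x⌋ : ℤ) : Fin n)) (Γ ((⌊x⌋ : ℤ) + 1 : Fin n)) (Int.fract x)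

lemma polyline_int_add (Γ : Fin n → Plane) (k : ℤ) {s : ℝ} (hs : s ∈ Set.Icc (0 : ℝ) 1) :
    polyline Γ (k + s) = AffineMap.lineMap (Γ (k : Fin n)) (Γ ((k : Fin n) + 1)) s := by
  -- At `s = 1` the floor jumps to `k + 1`, but both formulas give the common vertex.
  rcases hs.2.lt_or_eq with h | rfl
  · have hf : ⌊(k : ℝ) + s⌋ = k := by
      rw [Int.floor_eq_iff]; constructor <;> linarith [hs.1]
    have hr : Int.fract ((k : ℝ) + s) = s := by
      rw [Int.fract, hf]; ring
    rw [polyline, hf, hr]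
  · have : ((k : ℝ) + 1) = ((k + 1 : ℤ) : ℝ) := by push_cast; ring
    rw [polyline, this, Int.floor_intCast, Int.fract_intCast]
    simp

lemma polyline_int (Γ : Fin n → Plane) (k : ℤ) : polyline Γ k = Γ (k : Fin n) := by
  simpa using polyline_int_add Γ k (s := 0) (by simp)

lemma polyline_add_period (Γ : Fin n → Plane) (x : ℝ) (j : ℤ) :
    polyline Γ (x + j * n) = polyline Γ x := by
  have e : x + j * n = x + ((j * n : ℤ) : ℝ) := by push_cast; ring
  have h0 : (((j * n : ℤ)) : Fin n) = 0 := by push_cast; simp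
  rw [polyline, polyline, e, Int.floor_add_intCast, Int.fract_add_intCast, Int.cast_add, h0, add_zero]

/-- Affine pieces are glued along the locally finite closed cover by unit intervals. -/
lemma continuous_polyline (Γ : Fin n → Plane) : Continuous (polyline Γ) := by
  have hl : LocallyFinite fun k : ℤ => Set.Icc (k : ℝ) (k + 1) :=
    locallyFinite_Icc_of_tendsto tendsto_intCast_atTop_atTop
      (Filter.tendsto_atBot_add_const_right _ _ (tendsto_intCast_atBot_iff.2 Filter.tendsto_id))
  refine hl.continuous ?_ (fun k => isClosed_Icc) fun k => ?_
  · rw [Set.eq_univ_iff_forall]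
    intro x
    exact Set.mem_iUnion.2 ⟨⌊x⌋, Int.floor_le x, (Int.lt_floor_add_one x).le⟩
  · have : Set.EqOn (polyline Γ) (fun x : ℝ =>
        AffineMap.lineMap (Γ (k : Fin n)) (Γ ((k : Fin n) + 1)) (x - k)) (Set.Icc (k : ℝ) (k + 1)) := by
      intro x hx
      have := polyline_int_add Γ k (s := x - k) ⟨by linarith [hx.1], by linarith [hx.2]⟩
      simpa using this
    refine ContinuousOn.congr ?_ this
    exact (AffineMap.lineMap_continuous.comp (continuous_id.sub continuous_const)).continuousOn

/-- Simplicity of the polygon amounts to injectivity modulo the period. Distinct edges share at most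
a vertex, and since fractional parts are less than 1, it would have to be the initial vertex of
both. -/
lemma polyline_eq_imp (hn : 3 ≤ n) {Γ : Fin n → Plane}
    (hΓ : IsDrawing (SimpleGraph.cycleGraph n) Γ) {x y : ℝ} (h : polyline Γ x = polyline Γ y) :
    ∃ j : ℤ, x - y = j * n := by
  obtain ⟨hinj, -, hcross⟩ := hΓ
  have h1 := (Fin.one_ne_zero_and_two_ne_zero hn).1
  have h2 := (Fin.one_ne_zero_and_two_ne_zero hn).2
  have hne : ∀ k : Fin n, Γ k ≠ Γ (k + 1) := fun k hk => h1 (by simpa using hinj hk)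
  have hadj : ∀ k : Fin n, (SimpleGraph.cycleGraph n).Adj k (k + 1) := fun k =>
    (cycleGraph_adj_iff hn).2 (Or.inl rfl)
  -- a point of an edge, other than its final vertex, that is a vertex is the initial vertex
  have hvert : ∀ (z : ℝ) (w : Fin n), (w = (⌊z⌋ : ℤ) ∨ w = ((⌊z⌋ : ℤ) + 1 : Fin n)) →
      polyline Γ z = Γ w → w = ((⌊z⌋ : ℤ) : Fin n) ∧ Int.fract z = 0 := by
    rintro z w (rfl | rfl) hz
    · refine ⟨rfl, ?_⟩
      rw [polyline] at hz
      exact AffineMap.lineMap_injective ℝ (hne _)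
        (hz.trans (AffineMap.lineMap_apply_zero _ _).symm)
    · exfalso
      rw [polyline] at hz
      have := AffineMap.lineMap_injective ℝ (hne _)
        (hz.trans (AffineMap.lineMap_apply_one _ _).symm)
      exact (Int.fract_lt_one z).ne this
  have hmem : ∀ z : ℝ, polyline Γ z ∈
      segment ℝ (Γ ((⌊z⌋ : ℤ) : Fin n)) (Γ ((⌊z⌋ : ℤ) + 1 : Fin n)) := fun z => by
    rw [segment_eq_image_lineMap]
    exact ⟨Int.fract z, ⟨Int.fract_nonneg z, (Int.fract_lt_one z).le⟩, rfl⟩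
  by_cases hk : ((⌊x⌋ : ℤ) : Fin n) = ((⌊y⌋ : ℤ) : Fin n)
  · obtain ⟨j, hj⟩ := (Fin.intCast_eq_iff _ _).1 hk
    refine ⟨j, ?_⟩
    rw [polyline, polyline, hk] at h
    have hf := AffineMap.lineMap_injective ℝ (hne _) h
    rw [← Int.floor_add_fract x, ← Int.floor_add_fract y, hf]
    have : (⌊x⌋ : ℝ) - ⌊y⌋ = j * n := by exact_mod_cast hj
    linarith
  · exfalso
    -- Two edges with different initial vertices could only coincide reversed, which would force `2
    -- = 0` in `Fin n`.
    have hs : s(((⌊x⌋ : ℤ) : Fin n), ((⌊x⌋ : ℤ) + 1 : Fin n)) ≠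
        s(((⌊y⌋ : ℤ) : Fin n), ((⌊y⌋ : ℤ) + 1 : Fin n)) := by
      rw [Ne, Sym2.eq_iff]
      rintro (⟨h, -⟩ | ⟨h, h'⟩)
      · exact hk h
      · rw [h] at h'
        apply h2
        have : ((⌊y⌋ : ℤ) : Fin n) + 1 + 1 - ((⌊y⌋ : ℤ) : Fin n) = 0 := by rw [h']; abel
        rw [← this]; ring
    obtain ⟨w, ⟨hw1, hw2⟩, hw⟩ := hcross _ _ _ _ (hadj _) (hadj _) hs ⟨hmem x, h ▸ hmem y⟩
    have e1 := hvert x w (by simpa using hw1) hw.symm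
    have e2 := hvert y w (by simpa using hw2) (h ▸ hw.symm)
    exact hk (e1.1.symm.trans e2.1)

lemma polyline_mem_drawnSet (hn : 3 ≤ n) (Γ : Fin n → Plane) (x : ℝ) :
    polyline Γ x ∈ drawnSet (SimpleGraph.cycleGraph n) Γ := by
  refine segment_subset_drawnSet Γ (u := ((⌊x⌋ : ℤ) : Fin n)) (v := ((⌊x⌋ : ℤ) + 1 : Fin n))
    ((cycleGraph_adj_iff hn).2 (Or.inl rfl)) ?_
  rw [segment_eq_image_lineMap]
  exact ⟨Int.fract x, ⟨Int.fract_nonneg x, (Int.fract_lt_one x).le⟩, rfl⟩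

/-- The edge `uv` of the drawing of the cycle whose vertices have slid by `τ` along the polygon. -/
noncomputable def slidEdge (Γ : Fin n → Plane) (τ : ℝ) (u v : Fin n) (s : I) : Plane :=
  if v = u + 1 then polyline Γ (u.val + τ + s) else polyline Γ (u.val + τ - s)

lemma Fin.add_one_ne_self_add_one (hn : 3 ≤ n) (u : Fin n) : u ≠ u + 1 + 1 := by
  intro h
  apply (Fin.one_ne_zero_and_two_ne_zero hn).2
  have : u + 1 + 1 - u = 0 := by rw [← h]; abel
  rw [← this]; ring

lemma Fin.exists_val_add_one (u : Fin n) : ∃ j : ℤ, ((u + 1 : Fin n).val : ℝ) = u.val + 1 + j * n := by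
  obtain ⟨j, hj⟩ := (Fin.intCast_eq_iff (n := n) ((u + 1 : Fin n).val : ℤ) (u.val + 1 : ℤ)).1
    (by push_cast; simp)
  refine ⟨j, ?_⟩
  have : (((u + 1 : Fin n).val : ℤ) : ℝ) - ((u.val + 1 : ℤ) : ℝ) = j * n := by exact_mod_cast hj
  push_cast at this
  linarith

/-- The backward arc starts at the parameter of `(u + 1).val`, which differs from `u.val + 1` by a
multiple of the period when the index wraps around. -/
lemma slidEdge_symm (hn : 3 ≤ n) (Γ : Fin n → Plane) (τ : ℝ) {u v : Fin n}
    (h : (SimpleGraph.cycleGraph n).Adj u v) (s : I) :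
    slidEdge Γ τ v u s = slidEdge Γ τ u v (unitInterval.symm s) := by
  have key : ∀ (u : Fin n) (r : ℝ), polyline Γ ((u + 1 : Fin n).val + τ - r) =
      polyline Γ (u.val + τ + (1 - r)) := by
    intro u r
    obtain ⟨j, hj⟩ := Fin.exists_val_add_one u
    rw [hj, ← polyline_add_period Γ (u.val + τ + (1 - r)) j]
    congr 1
    ring
  rcases (cycleGraph_adj_iff hn).1 h with rfl | rfl
  · simp only [slidEdge, Fin.add_one_ne_self_add_one hn u, if_false, if_true]
    simp only [unitInterval.coe_symm_eq]
    exact key u s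
  · simp only [slidEdge, Fin.add_one_ne_self_add_one hn v, if_false, if_true]
    simp only [unitInterval.coe_symm_eq]
    rw [key]
    congr 1
    ring

lemma Fin.eq_of_val_sub_val {u v : Fin n} {j : ℤ} (h : (u.val : ℝ) - v.val = j * n) : u = v := by
  have : ((u.val : ℤ) : Fin n) = ((v.val : ℤ) : Fin n) :=
    (Fin.intCast_eq_iff _ _).2 ⟨j, by exact_mod_cast h⟩
  simpa using this

/-- By `polyline_eq_imp`, points coincide only if their parameters agree modulo `n`. For arcs
starting at `a + τ` and `b + τ`, the local parameters `s` and `r` of a common point then differ by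
an integer in `{-1, 0, 1}`: 0 means the same arc, and ±1 means a common end vertex. -/
lemma isCurvedDrawing_slid (hn : 3 ≤ n) {Γ : Fin n → Plane}
    (hΓ : IsDrawing (SimpleGraph.cycleGraph n) Γ) (τ : ℝ) :
    IsCurvedDrawing (SimpleGraph.cycleGraph n) (fun u => polyline Γ (u.val + τ))
      (slidEdge Γ τ) := by
  have hrange : ∀ u v, (SimpleGraph.cycleGraph n).Adj u v →
      Set.range (slidEdge Γ τ v u) = Set.range (slidEdge Γ τ u v) := by
    intro u v h
    have : slidEdge Γ τ v u = slidEdge Γ τ u v ∘ unitInterval.symm :=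
      funext fun s => slidEdge_symm hn Γ τ h s
    rw [this]
    exact Function.Surjective.range_comp (fun s => ⟨unitInterval.symm s, unitInterval.symm_symm s⟩) _
  have hsucc : ∀ (u : Fin n) (s : I), slidEdge Γ τ u (u + 1) s = polyline Γ (u.val + τ + s) :=
    fun u s => by simp [slidEdge]
  -- forward representatives of edges
  have hrep : ∀ u v, (SimpleGraph.cycleGraph n).Adj u v → ∃ a : Fin n, s(u, v) = s(a, a + 1) ∧
      ({u, v} : Set (Fin n)) = {a, a + 1} ∧
      Set.range (slidEdge Γ τ u v) = Set.range (slidEdge Γ τ a (a + 1)) := by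
    intro u v h
    rcases (cycleGraph_adj_iff hn).1 h with rfl | rfl
    · exact ⟨u, rfl, rfl, rfl⟩
    · exact ⟨v, Sym2.eq_swap, Set.pair_comm _ _, hrange _ _ h.symm⟩
  have hdisc : ∀ {x : ℝ} {a b : Fin n} {j : ℤ}, (a.val : ℝ) - b.val + x = j * n → ∃ i : ℤ, x = i := by
    intro x a b j h
    exact ⟨j * n - (a.val - b.val), by push_cast; linarith⟩
  have hone : ∀ {a b : Fin n} {j : ℤ}, (a.val : ℝ) - b.val - 1 = j * n → a = b + 1 := by
    intro a b j h
    obtain ⟨i, hi⟩ := Fin.exists_val_add_one b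
    refine Fin.eq_of_val_sub_val (j := j - i) ?_
    rw [hi]; push_cast; linarith
  have hposinj : Function.Injective fun u : Fin n => polyline Γ (u.val + τ) := by
    intro u v huv
    obtain ⟨j, hj⟩ := polyline_eq_imp hn hΓ huv
    exact Fin.eq_of_val_sub_val (j := j) (by linarith)
  refine ⟨⟨hposinj, ?_, ?_⟩, ?_⟩
  · intro u v w huv hw
    obtain ⟨a, -, hset, hr⟩ := hrep u v huv
    simp only [hr] at hw
    obtain ⟨s, hs⟩ := hw
    suffices w ∈ ({u, v} : Set (Fin n)) by simpa using this
    rw [hset]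
    rw [hsucc] at hs
    obtain ⟨j, hj⟩ := polyline_eq_imp hn hΓ hs.symm
    obtain ⟨i, hi⟩ := hdisc (x := -(s : ℝ)) (a := w) (b := a) (j := j) (by linarith)
    have hi0 : (i : ℝ) ≤ 0 := by linarith [s.2.1]
    have hi1 : (-1 : ℝ) ≤ i := by linarith [s.2.2]
    have hi0' : i ≤ 0 := by exact_mod_cast hi0
    have hi1' : -1 ≤ i := by exact_mod_cast hi1
    obtain rfl | rfl : i = 0 ∨ i = -1 := by omega
    · left
      exact Fin.eq_of_val_sub_val (j := j) (by push_cast at hi; linarith)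
    · right
      exact hone (j := j) (by push_cast at hi; linarith)
  · intro u v x y huv hxy hne p hp
    obtain ⟨a, ha, hset, hr⟩ := hrep u v huv
    obtain ⟨b, hb, hset', hr'⟩ := hrep x y hxy
    rw [ha, hb] at hne
    simp only [hr, hr'] at hp
    rw [hset, hset']
    obtain ⟨⟨s, hs⟩, r, hrr⟩ := hp
    rw [hsucc] at hs hrr
    obtain ⟨j, hj⟩ := polyline_eq_imp hn hΓ (hs.trans hrr.symm)
    obtain ⟨i, hi⟩ := hdisc (x := (s : ℝ) - r) (a := a) (b := b) (j := j) (by linarith)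
    have hi0 : (i : ℝ) ≤ 1 := by linarith [s.2.2, r.2.1]
    have hi1 : (-1 : ℝ) ≤ i := by linarith [s.2.1, r.2.2]
    have hi0' : i ≤ 1 := by exact_mod_cast hi0
    have hi1' : -1 ≤ i := by exact_mod_cast hi1
    obtain rfl | rfl | rfl : i = 0 ∨ i = 1 ∨ i = -1 := by omega
    · exfalso
      have : a = b := Fin.eq_of_val_sub_val (j := j) (by push_cast at hi; linarith)
      exact hne (by rw [this])
    · have hr0 : (r : ℝ) = 0 := by push_cast at hi; linarith [s.2.2, r.2.1]
      have : b = a + 1 := hone (j := -j) (by push_cast at hi ⊢; linarith)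
      refine ⟨b, ⟨by simp [this], by simp⟩, ?_⟩
      rw [← hrr, hr0, add_zero]
    · have hs0 : (s : ℝ) = 0 := by push_cast at hi; linarith [r.2.2, s.2.1]
      have : a = b + 1 := hone (j := j) (by push_cast at hi ⊢; linarith)
      refine ⟨a, ⟨by simp, by simp [this]⟩, ?_⟩
      rw [← hs, hs0, add_zero]
  · have hcontinj : ∀ u : Fin n, Continuous (slidEdge Γ τ u (u + 1)) ∧
        Function.Injective (slidEdge Γ τ u (u + 1)) := by
      intro u
      have : slidEdge Γ τ u (u + 1) = fun s : I => polyline Γ (u.val + τ + s) := funext (hsucc u)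
      rw [this]
      refine ⟨(continuous_polyline Γ).comp (by fun_prop), ?_⟩
      intro s r hsr
      obtain ⟨j, hj⟩ := polyline_eq_imp hn hΓ hsr
      have h1 : (j : ℝ) * n ≤ 1 := by linarith [s.2.2, r.2.1]
      have h2 : -1 ≤ (j : ℝ) * n := by linarith [s.2.1, r.2.2]
      have h1' : j * n ≤ 1 := by exact_mod_cast h1
      have h2' : -1 ≤ j * n := by exact_mod_cast h2
      have hj0 : j = 0 := by
        have hnz : (3 : ℤ) ≤ n := by exact_mod_cast hn
        by_contra hne
        rcases lt_or_gt_of_ne hne with h | h <;> nlinarith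
      rw [hj0] at hj
      apply Subtype.ext
      push_cast at hj
      linarith
    have hends : ∀ u : Fin n, slidEdge Γ τ u (u + 1) 0 = polyline Γ (u.val + τ) ∧
        slidEdge Γ τ u (u + 1) 1 = polyline Γ ((u + 1 : Fin n).val + τ) := by
      intro u
      obtain ⟨j, hj⟩ := Fin.exists_val_add_one u
      refine ⟨by simp [hsucc], ?_⟩
      rw [hsucc, hj, ← polyline_add_period Γ _ j]
      congr 1
      push_cast
      ring
    intro u v huv
    have hsymm : ∀ s, slidEdge Γ τ v u s = slidEdge Γ τ u v (unitInterval.symm s) :=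
      slidEdge_symm hn Γ τ huv
    rcases (cycleGraph_adj_iff hn).1 huv with rfl | rfl
    · exact ⟨(hcontinj u).1, (hcontinj u).2, (hends u).1, (hends u).2, hsymm⟩
    · have e : slidEdge Γ τ (v + 1) v = slidEdge Γ τ v (v + 1) ∘ unitInterval.symm :=
        funext fun s => slidEdge_symm hn Γ τ huv.symm s
      refine ⟨?_, ?_, ?_, ?_, hsymm⟩
      · rw [e]
        exact (hcontinj v).1.comp unitInterval.continuous_symm
      · rw [e]
        exact (hcontinj v).2.comp (fun s r h => by simpa using congrArg unitInterval.symm h)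
      · rw [e, Function.comp_apply, unitInterval.symm_zero, (hends v).2]
      · rw [e, Function.comp_apply, unitInterval.symm_one, (hends v).1]

/-- A drawing of a cycle can slide along itself into any of its shifts; hence these are compatible
with respect to all obstacles off the drawing. -/
theorem compatible_shift (hn : 3 ≤ n) {Γ : Fin n → Plane}
    (hΓ : IsDrawing (SimpleGraph.cycleGraph n) Γ) {P : Set Plane}
    (hP : Disjoint (drawnSet (SimpleGraph.cycleGraph n) Γ) P) (o : Fin n) :
    Compatible (SimpleGraph.cycleGraph n) Γ (fun i => Γ (i + o)) P := by
  have hslid : ∀ (o : Fin n) (u v : Fin n), (SimpleGraph.cycleGraph n).Adj u v →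
      slidEdge Γ o.val u v = straightEdge (fun i => Γ (i + o)) u v := by
    have hfwd : ∀ (o u : Fin n), slidEdge Γ o.val u (u + 1) =
        straightEdge (fun i => Γ (i + o)) u (u + 1) := by
      intro o u
      funext s
      have e : (u.val : ℝ) + o.val = ((u.val + o.val : ℤ) : ℝ) := by push_cast; ring
      simp only [slidEdge, if_true, e, polyline_int_add Γ _ s.2, straightEdge]
      push_cast
      simp [add_right_comm]
    intro o u v huv
    rcases (cycleGraph_adj_iff hn).1 huv with rfl | rfl
    · exact hfwd o u
    · funext s
      rw [slidEdge_symm hn Γ _ huv.symm, hfwd]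
      simp [straightEdge, AffineMap.lineMap_apply_one_sub]
  have hpos : ∀ o u : Fin n, polyline Γ (u.val + o.val) = Γ (u + o) := by
    intro o u
    have e : (u.val : ℝ) + o.val = ((u.val + o.val : ℤ) : ℝ) := by push_cast; ring
    rw [e, polyline_int]
    push_cast
    simp
  have hγ := continuous_polyline Γ
  refine ⟨fun t u => polyline Γ (u.val + t * o.val), fun t => slidEdge Γ (t * o.val),
    ?_, ?_, fun t => isCurvedDrawing_slid hn hΓ _, ?_, ?_, ?_, ?_, ?_⟩
  · intro v
    exact hγ.comp (by fun_prop)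
  · intro u v _
    simp only [slidEdge]
    split_ifs
    · exact hγ.comp (by fun_prop)
    · exact hγ.comp (by fun_prop)
  · intro t
    refine hP.mono_left ?_
    rintro p (⟨u, rfl⟩ | ⟨u, v, -, s, rfl⟩)
    · exact polyline_mem_drawnSet hn Γ _
    · simp only [slidEdge]
      split_ifs <;> exact polyline_mem_drawnSet hn Γ _
  · funext u
    simpa using hpos 0 u
  · intro u v huv
    simpa using hslid 0 u v huv
  · funext u
    simpa using hpos o u
  · intro u v huv
    simpa using hslid o u v huv

end Polyline

/-! ### Shifted versions are rotations. -/

/-- Two drawings of a graph with equal vertex sets and equal point sets have the same edges. -/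
lemma exists_adj_of_drawnSet_eq {V : Type*} [Finite V] {G : SimpleGraph V} {Γ Γ' : V → Plane}
    (hΓ : IsDrawing G Γ) (hΓ' : IsDrawing G Γ') (hset : drawnSet G Γ = drawnSet G Γ')
    (ρ : V → V) (hρ : ∀ v, Γ' v = Γ (ρ v)) (hsurj : Function.Surjective ρ) {u v : V}
    (huv : G.Adj u v) : G.Adj (ρ u) (ρ v) := by
  classical
  obtain ⟨hinj', hvert', -⟩ := hΓ'
  obtain ⟨hinj, hvert, hcross⟩ := hΓ
  set S := openSegment ℝ (Γ' u) (Γ' v) with hS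
  have hne : Γ' u ≠ Γ' v := fun h => huv.ne (hinj' h)
  have hSsub : S ⊆ segment ℝ (Γ' u) (Γ' v) := openSegment_subset_segment ℝ _ _
  have hSvert : ∀ w, Γ w ∉ S := by
    intro w hw
    obtain ⟨w, rfl⟩ := hsurj w
    rw [← hρ] at hw
    rcases hvert' u v w huv (hSsub hw) with rfl | rfl
    · exact hne (left_mem_openSegment_iff.1 hw)
    · exact hne (right_mem_openSegment_iff.1 hw)
  have hcover : ∀ p ∈ S, ∃ x y, G.Adj x y ∧ p ∈ segment ℝ (Γ x) (Γ y) := by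
    intro p hp
    have : p ∈ drawnSet G Γ := hset ▸ segment_subset_drawnSet Γ' huv (hSsub hp)
    rcases this with ⟨w, rfl⟩ | h
    · exact absurd hp (hSvert w)
    · exact h
  have hSne : (midpoint ℝ (Γ' u) (Γ' v)) ∈ S := by
    rw [hS, openSegment_eq_image_lineMap]
    exact ⟨1 / 2, by norm_num, by simp [midpoint]⟩
  obtain ⟨x, y, hxy, hm⟩ := hcover _ hSne
  have hclosed : ∀ a b : V, IsClosed (segment ℝ (Γ a) (Γ b)) := fun a b => by
    rw [segment_eq_image_lineMap]
    exact (isCompact_Icc.image AffineMap.lineMap_continuous).isClosed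
  -- The edge `xy` and the union `B` of the other edges are closed and meet only in vertices. The
  -- open edge `S` is connected, avoids all vertices and meets `xy`, so it lies in `xy`.
  let B : Set Plane := ⋃ e ∈ {e : V × V | G.Adj e.1 e.2 ∧ s(e.1, e.2) ≠ s(x, y)},
    segment ℝ (Γ e.1) (Γ e.2)
  have hB : IsClosed B := (Set.toFinite _).isClosed_biUnion fun e _ => hclosed _ _
  have hpre : IsPreconnected S := (convex_openSegment _ _).isPreconnected
  have hsub : S ⊆ segment ℝ (Γ x) (Γ y) := by
    have hSB : S ⊆ segment ℝ (Γ x) (Γ y) ∪ B := by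
      intro p hp
      obtain ⟨a, b, hab, hpab⟩ := hcover p hp
      by_cases h : s(a, b) = s(x, y)
      · left
        rcases Sym2.eq_iff.1 h with ⟨rfl, rfl⟩ | ⟨rfl, rfl⟩
        · exact hpab
        · rwa [segment_symm]
      · right
        exact Set.mem_biUnion (x := (a, b)) ⟨hab, h⟩ hpab
    have hdisj : S ∩ (segment ℝ (Γ x) (Γ y) ∩ B) = ∅ := by
      rw [Set.eq_empty_iff_forall_notMem]
      rintro p ⟨hp, hp1, hp2⟩
      obtain ⟨⟨a, b⟩, ⟨hab, h⟩, hp3⟩ := Set.mem_iUnion₂.1 hp2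
      obtain ⟨w, -, rfl⟩ := hcross a b x y hab hxy h ⟨hp3, hp1⟩
      exact hSvert w hp
    rcases isPreconnected_iff_subset_of_disjoint_closed.1 hpre _ _ (hclosed x y) hB hSB hdisj
      with h | h
    · exact h
    · have : midpoint ℝ (Γ' u) (Γ' v) ∈ S ∩ (segment ℝ (Γ x) (Γ y) ∩ B) := ⟨hSne, hm, h hSne⟩
      rw [hdisj] at this
      exact absurd this (Set.notMem_empty _)
  have hsub' : segment ℝ (Γ' u) (Γ' v) ⊆ segment ℝ (Γ x) (Γ y) :=
    segment_subset_closure_openSegment.trans (closure_minimal hsub (hclosed x y))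
  have hu := hvert x y (ρ u) hxy (hρ u ▸ hsub' (left_mem_segment ℝ _ _))
  have hv := hvert x y (ρ v) hxy (hρ v ▸ hsub' (right_mem_segment ℝ _ _))
  have hρne : ρ u ≠ ρ v := fun h => hne (by rw [hρ, hρ, h])
  rcases hu with hu | hu <;> rcases hv with hv | hv <;> rw [hu, hv] at hρne ⊢
  · exact absurd rfl hρne
  · exact hxy
  · exact hxy.symm
  · exact absurd rfl hρne

section Cycle

open scoped Fin.CommRing

variable {n : ℕ} [NeZero n]

/-- An injective map of a cycle that preserves adjacency is a rotation or a reflection. -/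
lemma cycleGraph_hom_eq (hn : 3 ≤ n) (ρ : Fin n → Fin n) (hρ : Function.Injective ρ)
    (hadj : ∀ u v, (SimpleGraph.cycleGraph n).Adj u v →
      (SimpleGraph.cycleGraph n).Adj (ρ u) (ρ v)) :
    (∃ o, ∀ i, ρ i = i + o) ∨ ∃ o, ∀ i, ρ i = o - i := by
  have step : ∀ i, ρ (i + 1) = ρ i + 1 ∨ ρ i = ρ (i + 1) + 1 := fun i =>
    (cycleGraph_adj_iff hn).1 (hadj _ _ ((cycleGraph_adj_iff hn).2 (Or.inl rfl)))
  have hne : ∀ i, ρ (i + 1 + 1) ≠ ρ i := fun i h => Fin.add_one_ne_self_add_one hn i (hρ h).symm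
  have hind : ∀ p : Fin n → Prop, p 0 → (∀ i, p i → p (i + 1)) → ∀ i, p i := by
    intro p h0 hs i
    have : ∀ k : ℕ, p (k : Fin n) := by
      intro k
      induction k with
      | zero => simpa using h0
      | succ k ih => simpa using hs _ ih
    simpa using this i.val
  -- The direction of the first step propagates, since turning back would violate injectivity.
  rcases step 0 with h0 | h0
  · left
    have : ∀ i, ρ (i + 1) = ρ i + 1 := by
      refine hind _ h0 fun i hi => (step (i + 1)).resolve_right fun h => ?_
      apply hne i
      rw [hi] at h
      exact (add_right_cancel h).symm
    refine ⟨ρ 0, hind _ (by simp) fun i hi => ?_⟩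
    rw [this, hi]
    abel
  · right
    have : ∀ i, ρ i = ρ (i + 1) + 1 := by
      refine hind _ h0 fun i hi => (step (i + 1)).resolve_left fun h => ?_
      apply hne i
      rw [h, ← hi]
    refine ⟨ρ 0, hind _ (by simp) fun i hi => ?_⟩
    have := this i
    rw [hi] at this
    rw [sub_add_eq_sub_sub, this]
    abel

lemma signedArea_reflect (Γ : Fin n → Plane) (o : Fin n) :
    signedArea (fun i => Γ (o - i)) = -signedArea Γ := by
  unfold signedArea
  rw [← neg_div, ← Finset.sum_neg_distrib]
  congr 1
  -- Edge `i, i + 1` of the reflection is the edge starting at `o - i - 1`, traversed backwards.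
  refine Fintype.sum_equiv ((Equiv.subLeft o).trans (Equiv.subRight 1)) _ _ fun i => ?_
  simp only [finRotate_apply, Equiv.trans_apply, Equiv.subLeft_apply, Equiv.subRight_apply,
    sub_add_cancel, sub_add_eq_sub_sub]
  ring

/-- A shifted version of a drawing of a cycle with nonzero signed area is a rotation. -/
theorem IsShiftedVersion.exists_shift (hn : 3 ≤ n) {Γ Γ' : Fin n → Plane}
    (h : IsShiftedVersion Γ Γ') (harea : signedArea Γ ≠ 0) :
    ∃ o : Fin n, o ≠ 0 ∧ Γ' = fun i => Γ (i + o) := by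
  obtain ⟨hΓ, hΓ', hsign, hne, hset, hrange⟩ := h
  have : ∀ v, ∃ w, Γ w = Γ' v := fun v => by
    have : Γ' v ∈ Set.range Γ := hrange ▸ Set.mem_range_self v
    exact this
  choose ρ hρ using this
  have hinj : Function.Injective ρ := fun u v huv => hΓ'.1 (by rw [← hρ, ← hρ, huv])
  have hadj : ∀ u v, (SimpleGraph.cycleGraph n).Adj u v →
      (SimpleGraph.cycleGraph n).Adj (ρ u) (ρ v) := fun u v huv =>
    exists_adj_of_drawnSet_eq hΓ hΓ' hset ρ (fun v => (hρ v).symm)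
      (Finite.surjective_of_injective hinj) huv
  rcases cycleGraph_hom_eq hn ρ hinj hadj with ⟨o, ho⟩ | ⟨o, ho⟩
  · have e : Γ' = fun i => Γ (i + o) := funext fun i => by rw [← hρ, ho]
    refine ⟨o, ?_, e⟩
    rintro rfl
    exact hne (by rw [e]; simp)
  · exfalso
    have e : Γ' = fun i => Γ (o - i) := funext fun i => by rw [← hρ, ho]
    rw [e, signedArea_reflect, Left.sign_neg] at hsign
    apply harea
    rcases lt_trichotomy (signedArea Γ) 0 with h | h | h
    · rw [sign_neg h] at hsign; exact absurd hsign (by decide)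
    · exact h
    · rw [sign_pos h] at hsign; exact absurd hsign (by decide)

end Cycle

/-! ### The points and edges of the double spiral. -/

/-- The signs `+, -, -, +, +, -, -, +, …`. -/
noncomputable def spiralSign (i : ℕ) : ℝ := (-1) ^ ((i + 1) / 2)

/-- The inverse slopes of the position vectors of the spiral points. -/
noncomputable def spiralSlope (n i : ℕ) : ℝ := (if Odd i then (n : ℝ) else 0) - i

/-- Points of a double spiral, ordered from the inside to the outside. -/
noncomputable def spiralPoint (n i : ℕ) : Plane :=
  !₂[spiralSign i * (4 * n) ^ i * spiralSlope n i, spiralSign i * (4 * n) ^ i]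

/-- The edges of the closed double spiral on the points `0, …, n - 1`. -/
def IsSpiralEdge (n a b : ℕ) : Prop :=
  (a = 0 ∧ b = 1) ∨ (b = a + 2 ∧ b < n) ∨ (a + 2 = n ∧ b + 1 = n)

lemma spiralSign_sq (i : ℕ) : spiralSign i * spiralSign i = 1 := by
  unfold spiralSign
  rw [← pow_add, ← two_mul, pow_mul]; simp

lemma spiralSign_cases (i : ℕ) : spiralSign i = 1 ∨ spiralSign i = -1 :=
  neg_one_pow_eq_or ℝ _

lemma spiralSign_add_two (i : ℕ) : spiralSign (i + 2) = -spiralSign i := by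
  unfold spiralSign
  rw [show (i + 2 + 1) / 2 = (i + 1) / 2 + 1 by omega, pow_succ]; ring

lemma spiralSign_succ_of_even {i : ℕ} (h : Even i) : spiralSign (i + 1) = -spiralSign i := by
  obtain ⟨k, rfl⟩ := h
  unfold spiralSign
  rw [show (k + k + 1 + 1) / 2 = (k + k + 1) / 2 + 1 by omega, pow_succ]; ring

lemma spiralSign_succ_of_odd {i : ℕ} (h : Odd i) : spiralSign (i + 1) = spiralSign i := by
  obtain ⟨k, rfl⟩ := h
  unfold spiralSign
  rw [show (2 * k + 1 + 1 + 1) / 2 = (2 * k + 1 + 1) / 2 by omega]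

lemma spiralSlope_of_even {n i : ℕ} (h : Even i) : spiralSlope n i = -i := by
  simp [spiralSlope, Nat.not_odd_iff_even.2 h]

lemma spiralSlope_of_odd {n i : ℕ} (h : Odd i) : spiralSlope n i = n - i := by
  simp [spiralSlope, h]

lemma spiralSlope_add_two (n i : ℕ) : spiralSlope n (i + 2) = spiralSlope n i - 2 := by
  rcases Nat.even_or_odd i with h | h
  · rw [spiralSlope_of_even h, spiralSlope_of_even (h.add even_two)]; push_cast; ring
  · rw [spiralSlope_of_odd h, spiralSlope_of_odd (h.add_even even_two)]; push_cast; ring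

lemma abs_spiralSlope_le {n i : ℕ} (h : i ≤ n) : |spiralSlope n i| ≤ n := by
  have : (i : ℝ) ≤ n := by exact_mod_cast h
  have : (0 : ℝ) ≤ i := by positivity
  rw [abs_le]
  rcases Nat.even_or_odd i with h | h
  · rw [spiralSlope_of_even h]; constructor <;> linarith
  · rw [spiralSlope_of_odd h]; constructor <;> linarith

lemma IsSpiralEdge.lt {n a b : ℕ} (h : IsSpiralEdge n a b) : a < b := by
  unfold IsSpiralEdge at h; omega

lemma IsSpiralEdge.sign {n a b : ℕ} (hn : Even n) (h : IsSpiralEdge n a b) :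
    spiralSign b = -spiralSign a := by
  rcases h with ⟨rfl, rfl⟩ | ⟨rfl, -⟩ | ⟨rfl, h⟩
  · exact spiralSign_succ_of_even Even.zero
  · exact spiralSign_add_two a
  · obtain rfl : b = a + 1 := by omega
    exact spiralSign_succ_of_even ((Nat.even_add.1 hn).2 even_two)

/-! ### Orientation tests: the spiral does not cross itself. -/

section Separation

/-- Twice the signed area of the triangle `pqr`. -/
noncomputable def cross (p q r : Plane) : ℝ :=
  (q 0 - p 0) * (r 1 - p 1) - (r 0 - p 0) * (q 1 - p 1)

lemma cross_left (p q : Plane) : cross p q p = 0 := by unfold cross; ring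

lemma cross_right (p q : Plane) : cross p q q = 0 := by unfold cross; ring

lemma cross_of_mem_segment {p q a b r : Plane} {α β : ℝ} (h : α + β = 1)
    (h0 : r 0 = α * a 0 + β * b 0) (h1 : r 1 = α * a 1 + β * b 1) :
    cross p q r = α * cross p q a + β * cross p q b := by
  unfold cross
  rw [h0, h1]
  linear_combination ((q 0 - p 0) * p 1 - p 0 * (q 1 - p 1)) * h

lemma cross_eq_zero_of_mem_segment {p q r : Plane} (h : r ∈ segment ℝ p q) : cross p q r = 0 := by
  obtain ⟨α, β, -, -, h, h0, h1⟩ := mem_segment_plane.1 h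
  rw [cross_of_mem_segment h h0 h1, cross_left, cross_right]; ring

/-- `cross p q` is affine and vanishes on the line `pq`; the factor `ε` lets one statement treat
both sides of the line. -/
lemma notMem_segment_of_cross_pos {p q a b r : Plane} {ε : ℝ} (ha : 0 < ε * cross p q a)
    (hb : 0 < ε * cross p q b) (h : r ∈ segment ℝ p q) : r ∉ segment ℝ a b := by
  intro h'
  obtain ⟨α, β, hα, hβ, hs, h0, h1⟩ := mem_segment_plane.1 h'
  have e := cross_of_mem_segment (p := p) (q := q) hs h0 h1
  rw [cross_eq_zero_of_mem_segment h] at e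
  rcases hα.lt_or_eq with h | h
  · have e' : 0 = α * (ε * cross p q a) + β * (ε * cross p q b) := by linear_combination ε * e
    linarith [mul_pos h ha, mul_nonneg hβ hb.le]
  · have : β = 1 := by linarith
    rw [← h, this] at e
    have : cross p q b = 0 := by linarith
    simp [this] at hb

lemma eq_of_mem_segment_of_cross {p q a b r : Plane} {ε : ℝ} (ha : cross p q a = 0)
    (hb : 0 < ε * cross p q b) (h : r ∈ segment ℝ p q) (h' : r ∈ segment ℝ a b) : r = a := by
  obtain ⟨α, β, hα, hβ, hs, h0, h1⟩ := mem_segment_plane.1 h'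
  have e := cross_of_mem_segment (p := p) (q := q) hs h0 h1
  rw [cross_eq_zero_of_mem_segment h, ha, mul_zero, zero_add] at e
  have hb0 : cross p q b ≠ 0 := fun h => by simp [h] at hb
  have hβ0 : β = 0 := (mul_eq_zero.1 e.symm).resolve_right hb0
  have hα1 : α = 1 := by linarith
  rw [hβ0, hα1] at h0 h1
  exact plane_ext (by linarith) (by linarith)

end Separation

lemma spiralPoint_zero (n i : ℕ) :
    spiralPoint n i 0 = spiralSign i * (4 * n) ^ i * spiralSlope n i := by simp [spiralPoint]

lemma spiralPoint_one (n i : ℕ) : spiralPoint n i 1 = spiralSign i * (4 * n) ^ i := by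
  simp [spiralPoint]

/-- The first term is the determinant of the position vectors of `a` and `b`; the rest is the
correction due to the point `j`. -/
lemma cross_spiralPoint (n : ℕ) {a b : ℕ} (h : spiralSign b = -spiralSign a) (j : ℕ) :
    cross (spiralPoint n a) (spiralPoint n b) (spiralPoint n j) =
      (4 * n) ^ a * (4 * n) ^ b * (spiralSlope n b - spiralSlope n a) -
      spiralSign a * spiralSign j * ((4 * n) ^ j * ((4 * n) ^ b * (spiralSlope n b - spiralSlope n j) +
        (4 * n) ^ a * (spiralSlope n a - spiralSlope n j))) := by
  unfold cross
  simp only [spiralPoint_zero, spiralPoint_one, h]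
  linear_combination ((4 * (n : ℝ)) ^ a * (4 * n) ^ b * (spiralSlope n b - spiralSlope n a)) *
    spiralSign_sq a

/-- Points before `a` are so close to the origin that the determinant dominates: the growth factor
`4 * n` outweighs the slope differences, which are at most `2 * n`. The bound is the size of the
main term for an edge from `a` to `a + 2`, whose slopes differ by 2. -/
lemma abs_cross_spiralPoint_sub_lt {n : ℕ} (hn : 0 < n) {a b j : ℕ}
    (h : spiralSign b = -spiralSign a) (hja : j < a) (hab : a < b) (hb : b ≤ n) :
    |cross (spiralPoint n a) (spiralPoint n b) (spiralPoint n j) -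
      (4 * n) ^ a * (4 * n) ^ b * (spiralSlope n b - spiralSlope n a)| <
        2 * ((4 * n) ^ a * (4 * n) ^ b) := by
  rw [cross_spiralPoint n h]
  have hn' : (1 : ℝ) ≤ n := by exact_mod_cast hn
  have hK : (1 : ℝ) ≤ 4 * n := by linarith
  have h1 : (4 * n : ℝ) ^ j * (4 * n) ≤ (4 * n) ^ a := by
    rw [← pow_succ]; exact pow_le_pow_right₀ hK hja
  have h2 : (4 * n : ℝ) ^ a ≤ (4 * n) ^ b := pow_le_pow_right₀ hK hab.le
  have pa : (0 : ℝ) < (4 * n) ^ a := by positivity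
  have pb : (0 : ℝ) < (4 * n) ^ b := by positivity
  have pj : (0 : ℝ) < (4 * n) ^ j := by positivity
  have ra := abs_le.1 (abs_spiralSlope_le (n := n) (i := a) (by omega))
  have rb := abs_le.1 (abs_spiralSlope_le (n := n) (i := b) (by omega))
  have rj := abs_le.1 (abs_spiralSlope_le (n := n) (i := j) (by omega))
  generalize (4 * n : ℝ) ^ a = A at *
  generalize (4 * n : ℝ) ^ b = B at *
  generalize (4 * n : ℝ) ^ j = J at *
  set X := B * (spiralSlope n b - spiralSlope n j) + A * (spiralSlope n a - spiralSlope n j)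
  have hX1 : X ≤ (A + B) * (2 * n) := by
    have := mul_le_mul_of_nonneg_left (show spiralSlope n b - spiralSlope n j ≤ 2 * n by linarith) pb.le
    have := mul_le_mul_of_nonneg_left (show spiralSlope n a - spiralSlope n j ≤ 2 * n by linarith) pa.le
    simp only [X]; linarith
  have hX2 : -((A + B) * (2 * n)) ≤ X := by
    have := mul_le_mul_of_nonneg_left (show -(2 * n) ≤ spiralSlope n b - spiralSlope n j by linarith) pb.le
    have := mul_le_mul_of_nonneg_left (show -(2 * n) ≤ spiralSlope n a - spiralSlope n j by linarith) pa.le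
    simp only [X]; linarith
  have hJ : J * ((A + B) * (2 * n)) < 2 * (A * B) := by
    have e : J * ((A + B) * (2 * n)) = (J * (4 * n)) * (A + B) / 2 := by ring
    rw [e]
    have := mul_le_mul_of_nonneg_right h1 (show 0 ≤ A + B by linarith)
    have := mul_le_mul_of_nonneg_left h2 pa.le
    have := mul_pos pa pb
    nlinarith
  have hJ1 := mul_le_mul_of_nonneg_left hX1 pj.le
  have hJ2 := mul_le_mul_of_nonneg_left hX2 pj.le
  rw [abs_lt]
  rcases spiralSign_cases a with e | e <;> rcases spiralSign_cases j with e' | e' <;>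
    rw [e, e'] <;> constructor <;> linarith

/-- The points preceding the outer end of an edge of the spiral lie on one side of the edge. -/
lemma exists_cross_spiralPoint_pos {n c d : ℕ} (hn : 6 ≤ n) (heven : Even n)
    (h : IsSpiralEdge n c d) :
    ∃ ε : ℝ, ∀ j ≤ d, j ≠ c → j ≠ d →
      0 < ε * cross (spiralPoint n c) (spiralPoint n d) (spiralPoint n j) := by
  have hn' : (6 : ℝ) ≤ n := by exact_mod_cast hn
  have hK : (0 : ℝ) < 4 * n := by linarith
  have hsign := h.sign heven
  rcases h with ⟨rfl, rfl⟩ | ⟨rfl, hd⟩ | ⟨h1, h2⟩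
  · exact ⟨0, fun j h1 h2 h3 => by omega⟩
  · refine ⟨-1, fun j h1 h2 h3 => ?_⟩
    have pc : (0 : ℝ) < (4 * n) ^ c := by positivity
    have pd : (0 : ℝ) < (4 * n) ^ (c + 2) := by positivity
    have pcd := mul_pos pc pd
    rcases lt_or_gt_of_ne h2 with h2 | h2
    · have := (abs_lt.1 (abs_cross_spiralPoint_sub_lt (by omega) hsign h2 (by omega) hd.le)).2
      rw [spiralSlope_add_two] at this
      linarith
    -- The point between the two ends is too far out for the estimate. Because odd slopes are raised
    -- by `n`, its correction has the same sign as the main term for either parity of `c`.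
    · obtain rfl : j = c + 1 := by omega
      have pj : (0 : ℝ) < (4 * n) ^ (c + 1) := by positivity
      rw [cross_spiralPoint n hsign, spiralSlope_add_two]
      generalize (4 * n : ℝ) ^ (c + 1) = J at *
      generalize (4 * n : ℝ) ^ (c + 2) = D at *
      generalize (4 * n : ℝ) ^ c = C at *
      have p1 := mul_pos pj pd
      have p2 := mul_pos pj pc
      have p1' := mul_pos p1 (show (0 : ℝ) < n - 1 by linarith)
      have p2' := mul_pos p2 (show (0 : ℝ) < n - 1 by linarith)
      rcases Nat.even_or_odd c with hc | hc
      · rw [spiralSign_succ_of_even hc, spiralSlope_of_even hc, spiralSlope_of_odd hc.add_one]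
        have := spiralSign_sq c
        rw [mul_neg, this]
        push_cast
        linarith
      · rw [spiralSign_succ_of_odd hc, spiralSlope_of_odd hc, spiralSlope_of_even hc.add_one]
        rw [spiralSign_sq c]
        push_cast
        linarith
  -- For the closing edge the slopes differ by `n - 1 > 2` with the opposite sign, so the estimate
  -- suffices.
  · refine ⟨1, fun j hj1 hj2 hj3 => ?_⟩
    have hc : Even c := by rw [← h1] at heven; exact (Nat.even_add.1 heven).2 even_two
    obtain rfl : d = c + 1 := by omega
    have := (abs_lt.1 (abs_cross_spiralPoint_sub_lt (n := n) (j := j) (by omega) hsign (by omega)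
      (by omega) (by omega))).1
    rw [spiralSlope_of_even hc, spiralSlope_of_odd hc.add_one] at this
    have pcd : (0 : ℝ) < (4 * n) ^ c * (4 * n) ^ (c + 1) := by positivity
    have := mul_pos pcd (show (0 : ℝ) < n - 3 by linarith)
    push_cast at *
    linarith

lemma spiralPoint_injective {n : ℕ} (hn : 0 < n) : Function.Injective (spiralPoint n) := by
  intro i j h
  have hn' : (1 : ℝ) ≤ n := by exact_mod_cast hn
  have hK : (1 : ℝ) < 4 * n := by linarith
  have h1 := congrArg (fun p : Plane => |p 1|) h
  have hs : ∀ i, |spiralSign i| = 1 := fun i => by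
    rcases spiralSign_cases i with e | e <;> rw [e] <;> simp
  simp only [spiralPoint_one, abs_mul, hs, one_mul, abs_pow, abs_of_pos (by linarith : (0 : ℝ) < 4 * n)] at h1
  exact pow_right_injective₀ (by linarith) hK.ne' h1

/-- Distinct edges of the spiral meet only in common ends. -/
lemma spiral_segment_inter {n a b c d : ℕ} (hn : 6 ≤ n) (heven : Even n) (hab : IsSpiralEdge n a b)
    (hcd : IsSpiralEdge n c d) (hne : ¬ (a = c ∧ b = d)) {p : Plane}
    (hp : p ∈ segment ℝ (spiralPoint n a) (spiralPoint n b))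
    (hp' : p ∈ segment ℝ (spiralPoint n c) (spiralPoint n d)) :
    ∃ j, (j = a ∨ j = b) ∧ (j = c ∨ j = d) ∧ p = spiralPoint n j := by
  -- Only the edge with the outer end further out is used as the separating line; both ends of the
  -- other edge then precede or equal that end.
  wlog hbd : b ≤ d generalizing a b c d
  · obtain ⟨j, h1, h2, h3⟩ := this hcd hab (fun h => hne ⟨h.1.symm, h.2.symm⟩) hp' hp (by omega)
    exact ⟨j, h2, h1, h3⟩
  have hab' := hab.lt
  have hcd' := hcd.lt
  obtain ⟨ε, hε⟩ := exists_cross_spiralPoint_pos hn heven hcd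
  have hzero : ∀ j, (j = c ∨ j = d) →
      cross (spiralPoint n c) (spiralPoint n d) (spiralPoint n j) = 0 := by
    rintro j (rfl | rfl)
    · exact cross_left _ _
    · exact cross_right _ _
  by_cases ha : a = c ∨ a = d
  · by_cases hb : b = c ∨ b = d
    · omega
    · refine ⟨a, Or.inl rfl, ha, ?_⟩
      exact eq_of_mem_segment_of_cross (hzero a ha)
        (hε b hbd (fun h => hb (Or.inl h)) (fun h => hb (Or.inr h))) hp' hp
  · have ha' := hε a (by omega) (fun h => ha (Or.inl h)) (fun h => ha (Or.inr h))
    by_cases hb : b = c ∨ b = d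
    · refine ⟨b, Or.inr rfl, hb, ?_⟩
      exact eq_of_mem_segment_of_cross (hzero b hb) ha' hp' (by rwa [segment_symm])
    · exact absurd hp (notMem_segment_of_cross_pos ha'
        (hε b hbd (fun h => hb (Or.inl h)) (fun h => hb (Or.inr h))) hp')

/-! ### The spiral as a drawing of the cycle. -/

/-- The position of vertex `k` of the cycle in the order of the spiral points: the cycle runs
through the even points inwards and then through the odd points outwards. -/
def spiralIndex {n : ℕ} (k : Fin n) : ℕ :=
  if 2 * k.val + 1 < n then n - 2 - 2 * k.val else 2 * k.val + 1 - n

/-- The drawing of the cycle `C_n` as a double spiral. -/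
noncomputable def spiralDrawing (n : ℕ) (k : Fin n) : Plane := spiralPoint n (spiralIndex k)

lemma spiralIndex_lt {n : ℕ} (heven : Even n) (k : Fin n) : spiralIndex k < n := by
  obtain ⟨m, rfl⟩ := heven
  have := k.2
  unfold spiralIndex
  split_ifs <;> omega

lemma spiralIndex_injective {n : ℕ} (heven : Even n) :
    Function.Injective (spiralIndex : Fin n → ℕ) := by
  obtain ⟨m, rfl⟩ := heven
  intro k l h
  have := k.2
  have := l.2
  unfold spiralIndex at h
  apply Fin.ext
  split_ifs at h <;> omega

lemma exists_spiralIndex_eq {n : ℕ} (heven : Even n) {j : ℕ} (hj : j < n) :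
    ∃ k : Fin n, spiralIndex k = j := by
  obtain ⟨m, rfl⟩ := heven
  rcases Nat.even_or_odd j with ⟨i, hi⟩ | ⟨i, hi⟩
  · refine ⟨⟨m - 1 - i, by omega⟩, ?_⟩
    unfold spiralIndex
    simp only
    split_ifs <;> omega
  · refine ⟨⟨m + i, by omega⟩, ?_⟩
    unfold spiralIndex
    simp only
    split_ifs <;> omega

lemma Fin.eq_add_one_iff {n : ℕ} [NeZero n] (hn : 3 ≤ n) {u v : Fin n} :
    v = u + 1 ↔ v.val = u.val + 1 ∨ (u.val + 1 = n ∧ v.val = 0) := by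
  have hu := u.2
  have hv := v.2
  rw [Fin.ext_iff, Fin.val_add, Fin.val_one', Nat.mod_eq_of_lt (show 1 < n by omega)]
  rcases Nat.lt_or_ge (u.val + 1) n with h | h
  · rw [Nat.mod_eq_of_lt h]; omega
  · have : u.val + 1 = n := by omega
    rw [this, Nat.mod_self]; omega

lemma adj_iff_isSpiralEdge {n : ℕ} (hn : 6 ≤ n) (heven : Even n) {u v : Fin n} :
    (SimpleGraph.cycleGraph n).Adj u v ↔
      IsSpiralEdge n (spiralIndex u) (spiralIndex v) ∨
      IsSpiralEdge n (spiralIndex v) (spiralIndex u) := by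
  have : NeZero n := ⟨by omega⟩
  rw [cycleGraph_adj_iff (by omega), Fin.eq_add_one_iff (by omega), Fin.eq_add_one_iff (by omega)]
  obtain ⟨m, rfl⟩ := heven
  have := u.2
  have := v.2
  unfold IsSpiralEdge spiralIndex
  split_ifs <;> omega

lemma spiralDrawing_injective {n : ℕ} (hn : 6 ≤ n) (heven : Even n) :
    Function.Injective (spiralDrawing n) :=
  (spiralPoint_injective (by omega)).comp (spiralIndex_injective heven)

lemma sign_of_adj {n : ℕ} (hn : 6 ≤ n) (heven : Even n) {u v : Fin n}
    (h : (SimpleGraph.cycleGraph n).Adj u v) :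
    spiralSign (spiralIndex v) = -spiralSign (spiralIndex u) := by
  rcases (adj_iff_isSpiralEdge hn heven).1 h with h | h
  · exact h.sign heven
  · rw [h.sign heven, neg_neg]

lemma spiralSign_mul_pos {n : ℕ} (hn : 0 < n) (i : ℕ) :
    0 < spiralSign i * spiralPoint n i 1 := by
  have : (0 : ℝ) < n := by exact_mod_cast hn
  rw [spiralPoint_one, ← mul_assoc, spiralSign_sq]
  positivity

/-- Reduction of a statement about the edges of the cycle to the edges of the spiral. -/
lemma exists_isSpiralEdge {n : ℕ} (hn : 6 ≤ n) (heven : Even n) {u v : Fin n}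
    (h : (SimpleGraph.cycleGraph n).Adj u v) :
    ∃ x y, s(u, v) = s(x, y) ∧ ({u, v} : Set (Fin n)) = {x, y} ∧
      IsSpiralEdge n (spiralIndex x) (spiralIndex y) ∧
      segment ℝ (spiralDrawing n u) (spiralDrawing n v) =
        segment ℝ (spiralDrawing n x) (spiralDrawing n y) := by
  rcases (adj_iff_isSpiralEdge hn heven).1 h with h | h
  · exact ⟨u, v, rfl, rfl, h, rfl⟩
  · exact ⟨v, u, Sym2.eq_swap, Set.pair_comm _ _, h, segment_symm ℝ _ _⟩

theorem isDrawing_spiralDrawing {n : ℕ} (hn : 6 ≤ n) (heven : Even n) :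
    IsDrawing (SimpleGraph.cycleGraph n) (spiralDrawing n) := by
  have : NeZero n := ⟨by omega⟩
  have hinj := spiralDrawing_injective hn heven
  have hcross : ∀ u v x y : Fin n, (SimpleGraph.cycleGraph n).Adj u v →
      (SimpleGraph.cycleGraph n).Adj x y → s(u, v) ≠ s(x, y) →
      segment ℝ (spiralDrawing n u) (spiralDrawing n v) ∩
        segment ℝ (spiralDrawing n x) (spiralDrawing n y) ⊆
        spiralDrawing n '' ({u, v} ∩ {x, y}) := by
    rintro u v x y huv hxy hne p ⟨hp, hp'⟩
    obtain ⟨a, b, e1, e2, hab, e3⟩ := exists_isSpiralEdge hn heven huv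
    obtain ⟨c, d, f1, f2, hcd, f3⟩ := exists_isSpiralEdge hn heven hxy
    rw [e1, f1] at hne
    rw [e3] at hp
    rw [f3] at hp'
    rw [e2, f2]
    obtain ⟨j, hj1, hj2, rfl⟩ := spiral_segment_inter hn heven hab hcd
      (fun h => hne (by rw [spiralIndex_injective heven h.1, spiralIndex_injective heven h.2]))
      hp hp'
    obtain ⟨k, rfl⟩ := exists_spiralIndex_eq heven
      (show j < n by rcases hj1 with rfl | rfl <;> exact spiralIndex_lt heven _)
    refine ⟨k, ⟨?_, ?_⟩, rfl⟩
    · exact hj1.imp (fun h => spiralIndex_injective heven h) fun h => spiralIndex_injective heven h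
    · exact hj2.imp (fun h => spiralIndex_injective heven h) fun h => spiralIndex_injective heven h
  refine ⟨hinj, fun u v w huv hw => ?_, hcross⟩
  by_contra! hne
  -- A vertex on a foreign edge is also a point of its own edge to `w + 1`, so the intersection
  -- property of edges applies.
  have hw1 : (SimpleGraph.cycleGraph n).Adj w (w + 1) :=
    (cycleGraph_adj_iff (by omega)).2 (Or.inl rfl)
  have hs : s(u, v) ≠ s(w, w + 1) := by
    rw [Ne, Sym2.eq_iff]
    rintro (⟨h, -⟩ | ⟨-, h⟩)
    · exact hne.1 h.symm
    · exact hne.2 h.symm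
  obtain ⟨k, ⟨hk, -⟩, hkw⟩ := hcross u v w (w + 1) huv hw1 hs ⟨hw, left_mem_segment ℝ _ _⟩
  rw [hinj hkw] at hk
  rcases hk with h | h
  · exact hne.1 h
  · exact hne.2 h

/-- The outermost edge contributes `-(K ^ (2 * n - 3) * (n - 1))`, which outweighs the at most `2 *
K ^ (2 * n - 6)` of each of the other `n - 1` edges. -/
theorem signedArea_spiralDrawing_neg {n : ℕ} (hn : 6 ≤ n) (heven : Even n) :
    signedArea (spiralDrawing n) < 0 := by
  have : NeZero n := ⟨by omega⟩
  have hn' : (6 : ℝ) ≤ n := by exact_mod_cast hn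
  have hK : (1 : ℝ) ≤ 4 * n := by linarith
  have hK0 : (0 : ℝ) < 4 * n := by linarith
  set K : ℝ := 4 * n with hKdef
  have hterm : ∀ a b, spiralSign b = -spiralSign a →
      spiralPoint n a 0 * spiralPoint n b 1 - spiralPoint n b 0 * spiralPoint n a 1 =
        K ^ (a + b) * (spiralSlope n b - spiralSlope n a) := by
    intro a b h
    simp only [spiralPoint_zero, spiralPoint_one, h, pow_add]
    linear_combination (K ^ a * K ^ b * (spiralSlope n b - spiralSlope n a)) * spiralSign_sq a
  let l : Fin n := ⟨n - 1, by omega⟩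
  have hbound : ∀ i ∈ Finset.univ.erase l, spiralDrawing n i 0 * spiralDrawing n (finRotate n i) 1 -
      spiralDrawing n (finRotate n i) 0 * spiralDrawing n i 1 ≤ 2 * K ^ (2 * n - 6) := by
    intro i hi
    have hil : i.val ≠ n - 1 := fun h => (Finset.mem_erase.1 hi).1 (Fin.ext h)
    have hi2 := i.2
    rw [finRotate_apply]
    have hadj : (SimpleGraph.cycleGraph n).Adj i (i + 1) :=
      (cycleGraph_adj_iff (by omega)).2 (Or.inl rfl)
    have hval : (i + 1 : Fin n).val = i.val + 1 := by
      have := (Fin.eq_add_one_iff (by omega)).1 (rfl : i + 1 = i + 1)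
      omega
    unfold spiralDrawing
    rw [hterm _ _ (sign_of_adj hn heven hadj)]
    have key : ((spiralIndex i = 0 ∧ spiralIndex (i + 1) = 1) ∨
        spiralIndex (i + 1) = spiralIndex i + 2) ∨
        (spiralIndex i = spiralIndex (i + 1) + 2 ∧ spiralIndex i + 2 ≤ n) := by
      obtain ⟨m, rfl⟩ := heven
      unfold spiralIndex
      rw [hval]
      split_ifs <;> omega
    rcases key with (⟨h1, h2⟩ | h) | ⟨h, h'⟩
    · rw [h1, h2, spiralSlope_of_even Even.zero, spiralSlope_of_odd odd_one]
      have : K ^ 2 ≤ K ^ (2 * n - 6) := pow_le_pow_right₀ hK (by omega)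
      have : K * (n - 1) ≤ K * K := mul_le_mul_of_nonneg_left (by linarith) hK0.le
      push_cast
      simp only [pow_one]
      nlinarith
    · rw [h, spiralSlope_add_two]
      have : 0 < K ^ (spiralIndex i + (spiralIndex i + 2)) := by positivity
      have : 0 < K ^ (2 * n - 6) := by positivity
      linarith
    · rw [h, spiralSlope_add_two, ← h]
      have : K ^ (spiralIndex i + spiralIndex (i + 1)) ≤ K ^ (2 * n - 6) :=
        pow_le_pow_right₀ hK (by omega)
      linarith
  have hlast : spiralDrawing n l 0 * spiralDrawing n (finRotate n l) 1 -
      spiralDrawing n (finRotate n l) 0 * spiralDrawing n l 1 = -(K ^ (2 * n - 3) * (n - 1)) := by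
    rw [finRotate_apply]
    have hl : l + 1 = 0 := ((Fin.eq_add_one_iff (by omega)).2 (Or.inr ⟨by simp only [l]; omega, by simp⟩)).symm
    have hadj : (SimpleGraph.cycleGraph n).Adj l 0 :=
      (cycleGraph_adj_iff (by omega)).2 (Or.inl hl.symm)
    rw [hl]
    unfold spiralDrawing
    rw [hterm _ _ (sign_of_adj hn heven hadj)]
    have h1 : spiralIndex l = n - 1 := by
      unfold spiralIndex; simp only [l]; split_ifs <;> omega
    have h2 : spiralIndex (0 : Fin n) = n - 2 := by
      rw [spiralIndex, if_pos (by simp; omega)]; simp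
    have e1 : Odd (n - 1) := Nat.Even.sub_odd (by omega) heven odd_one
    have e2 : Even (n - 2) := heven.tsub even_two
    rw [h1, h2, spiralSlope_of_odd e1, spiralSlope_of_even e2, Nat.cast_sub (by omega),
      Nat.cast_sub (by omega), show n - 1 + (n - 2) = 2 * n - 3 by omega]
    push_cast
    ring
  unfold signedArea
  rw [← Finset.sum_erase_add _ _ (Finset.mem_univ l), hlast]
  have hsum := Finset.sum_le_card_nsmul _ _ _ hbound
  rw [Finset.card_erase_of_mem (Finset.mem_univ l), Finset.card_univ, Fintype.card_fin,
    nsmul_eq_mul, Nat.cast_sub (by omega)] at hsum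
  have e : K ^ (2 * n - 3) = K ^ (2 * n - 6) * K ^ 3 := by rw [← pow_add]; congr 1; omega
  rw [e]
  have p6 : 0 < K ^ (2 * n - 6) := by positivity
  have hK3 : 2 < K ^ 3 := by
    have : K ^ 1 ≤ K ^ 3 := pow_le_pow_right₀ hK (by norm_num)
    linarith
  have := mul_lt_mul_of_pos_left hK3 (mul_pos p6 (show (0 : ℝ) < n - 1 by linarith))
  push_cast at hsum
  linarith

/-! ### Obstacles and the crossings of the spiral with the axis. -/

/-- The obstacle abscissae on the axis: the origin separates consecutive parallel edges of the
spiral, the second one separates the edges at the innermost odd point, and the third one separates the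
outermost edge from all other edges. -/
noncomputable def spiralObstacle (n : ℕ) : Fin 3 → ℝ :=
  ![0, -(4 * n), -(spiralSign (n - 2) * (4 * n) ^ (n - 2))]

/-- The offset of the crossing of the spiral edge `ab` with the axis from the abscissa `c`. -/
noncomputable def spiralOffset (n a b : ℕ) (c : ℝ) : ℝ :=
  crossOffset (spiralSign a) (spiralSign b) (spiralPoint n a) (spiralPoint n b) c

lemma spiralOffset_comm (n a b : ℕ) (c : ℝ) : spiralOffset n a b c = spiralOffset n b a c :=
  crossOffset_comm _ _ _ _ _

lemma spiralOffset_eq (n : ℕ) {a b : ℕ} (h : spiralSign b = -spiralSign a) (c : ℝ) :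
    spiralOffset n a b c = spiralSign a * ((4 * n) ^ a * (4 * n) ^ b) *
      (spiralSlope n a - spiralSlope n b) - c * ((4 * n) ^ a + (4 * n) ^ b) := by
  unfold spiralOffset crossOffset
  simp only [spiralPoint_zero, spiralPoint_one, h]
  linear_combination ((4 * n : ℝ) ^ b * (spiralSign a * (4 * n) ^ a * spiralSlope n a - c) +
    (4 * n : ℝ) ^ a * (-spiralSign a * (4 * n) ^ b * spiralSlope n b - c)) * spiralSign_sq a

/-- At `c = 0` the sign is that of `spiralSign i`. Consecutive edges of one arm therefore cross the
axis on alternating sides of the origin, at about `2 * spiralSign i * (4 * n) ^ i`. -/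
lemma spiralOffset_add_two (n i : ℕ) (c : ℝ) :
    spiralOffset n i (i + 2) c =
      2 * spiralSign i * ((4 * n) ^ i * (4 * n) ^ (i + 2)) -
        c * ((4 * n) ^ i + (4 * n) ^ (i + 2)) := by
  rw [spiralOffset_eq n (spiralSign_add_two i), spiralSlope_add_two]; ring

lemma spiralSign_zero : spiralSign 0 = 1 := by simp [spiralSign]

lemma spiralOffset_zero_one (n : ℕ) (c : ℝ) :
    spiralOffset n 0 1 c = -(n - 1) * (4 * n) - c * (1 + 4 * n) := by
  rw [spiralOffset_eq n (b := 1) (spiralSign_succ_of_even Even.zero), spiralSlope_of_even Even.zero,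
    spiralSlope_of_odd odd_one, spiralSign_zero]
  push_cast
  ring

lemma spiralOffset_last {n : ℕ} (hn : 2 ≤ n) (heven : Even n) (c : ℝ) :
    spiralOffset n (n - 2) (n - 1) c = (4 * n) ^ (n - 2) *
      (-(spiralSign (n - 2) * (n - 1) * (4 * n) ^ (n - 1)) - c * (1 + 4 * n)) := by
  have h2 : Even (n - 2) := heven.tsub even_two
  have h1 : Odd (n - 1) := Nat.Even.sub_odd (by omega) heven odd_one
  have e : n - 1 = n - 2 + 1 := by omega
  have h := spiralSign_succ_of_even h2
  rw [← e] at h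
  rw [spiralOffset_eq n h, spiralSlope_of_even h2, spiralSlope_of_odd h1, e, pow_succ,
    show n - 2 + 1 = n - 1 by omega, Nat.cast_sub (by omega), Nat.cast_sub (by omega)]
  push_cast
  ring

/-- The outermost edge crosses at about `n - 1` times the abscissa of the third obstacle. Every
other edge crosses nearer to the origin than this obstacle or on the other side of the origin. -/
lemma spiralOffset_third_pos {n a b : ℕ} (hn : 6 ≤ n) (heven : Even n) (h : IsSpiralEdge n a b)
    (hlast : a + 2 ≠ n ∨ b + 1 ≠ n) :
    0 < spiralSign (n - 2) * spiralOffset n a b (spiralObstacle n 2) := by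
  have hn' : (6 : ℝ) ≤ n := by exact_mod_cast hn
  have hK : (1 : ℝ) < 4 * n := by linarith
  have hK0 : (0 : ℝ) < 4 * n := by linarith
  have hobs : spiralObstacle n 2 = -(spiralSign (n - 2) * (4 * n) ^ (n - 2)) := rfl
  rw [hobs]
  have hσ := spiralSign_sq (n - 2)
  rcases h with ⟨rfl, rfl⟩ | ⟨rfl, hb⟩ | h
  · have h1 : (4 * n : ℝ) ^ 1 ≤ (4 * n) ^ (n - 2) := pow_le_pow_right₀ hK.le (by omega)
    have e : spiralSign (n - 2) * spiralOffset n 0 1 (-(spiralSign (n - 2) * (4 * n) ^ (n - 2))) =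
        spiralSign (n - 2) * (-(n - 1) * (4 * n)) + (4 * n) ^ (n - 2) * (1 + 4 * n) := by
      rw [spiralOffset_zero_one]
      linear_combination (4 * n) ^ (n - 2) * (1 + 4 * n) * hσ
    rw [e]
    have h2 := mul_le_mul_of_nonneg_right h1 (show (0 : ℝ) ≤ 1 + 4 * n by linarith)
    have h3 : 0 < (4 * n : ℝ) * (4 * n - (n - 1)) := mul_pos hK0 (by linarith)
    have h4 : 0 < (4 * n : ℝ) * (n - 1) := mul_pos hK0 (by linarith)
    rcases spiralSign_cases (n - 2) with e | e <;> rw [e] <;> nlinarith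
  · have e : spiralSign (n - 2) *
        spiralOffset n a (a + 2) (-(spiralSign (n - 2) * (4 * n) ^ (n - 2))) =
        2 * (spiralSign (n - 2) * spiralSign a) * ((4 * n) ^ a * (4 * n) ^ (a + 2)) +
        (4 * n) ^ (n - 2) * ((4 * n) ^ a + (4 * n) ^ (a + 2)) := by
      rw [spiralOffset_add_two]
      linear_combination (4 * n) ^ (n - 2) * ((4 * n) ^ a + (4 * n) ^ (a + 2)) * hσ
    rw [e]
    have pa : (0 : ℝ) < (4 * n) ^ a := by positivity
    have pb : (0 : ℝ) < (4 * n) ^ (a + 2) := by positivity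
    have pn : (0 : ℝ) < (4 * n) ^ (n - 2) := by positivity
    have pab := mul_pos pa pb
    have pn' := mul_pos pn (add_pos pa pb)
    have hcase : spiralSign (n - 2) * spiralSign a = 1 ∨ a + 2 ≤ n - 2 := by
      by_cases h : a + 2 ≤ n - 2
      · exact Or.inr h
      -- Here `a = n - 3` is odd, so the edge crosses on the side of the origin away from the
      -- obstacle.
      · left
        have hm : n - 2 = a + 1 := by omega
        have ho : Odd a := by
          have h2 : Even (n - 2) := heven.tsub even_two
          rw [hm] at h2
          exact Nat.not_even_iff_odd.1 fun h => Nat.not_even_iff_odd.2 h.add_one h2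
        rw [hm, spiralSign_succ_of_odd ho, spiralSign_sq]
    rcases hcase with h | h
    · rw [h]; linarith
    · have h1 : (4 * n : ℝ) ^ (a + 2) ≤ (4 * n) ^ (n - 2) := pow_le_pow_right₀ hK.le h
      have h2 : (4 * n : ℝ) ^ a < (4 * n) ^ (a + 2) := pow_lt_pow_right₀ hK (by omega)
      have h3 := mul_le_mul_of_nonneg_left h1 pa.le
      have h4 := mul_lt_mul_of_pos_left h2 pn
      have hs : -1 ≤ spiralSign (n - 2) * spiralSign a := by
        rcases spiralSign_cases (n - 2) with e | e <;> rcases spiralSign_cases a with e' | e' <;>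
          rw [e, e'] <;> norm_num
      have := mul_le_mul_of_nonneg_right hs pab.le
      linarith
  · omega

lemma spiralOffset_third_neg {n : ℕ} (hn : 6 ≤ n) (heven : Even n) :
    spiralSign (n - 2) * spiralOffset n (n - 2) (n - 1) (spiralObstacle n 2) < 0 := by
  have hn' : (6 : ℝ) ≤ n := by exact_mod_cast hn
  have hK0 : (0 : ℝ) < 4 * n := by linarith
  have hobs : spiralObstacle n 2 = -(spiralSign (n - 2) * (4 * n) ^ (n - 2)) := rfl
  have hpow : (4 * n : ℝ) ^ (n - 1) = (4 * n) ^ (n - 2) * (4 * n) := by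
    rw [← pow_succ]; congr 1; omega
  have e : spiralSign (n - 2) * spiralOffset n (n - 2) (n - 1) (spiralObstacle n 2) =
      -((4 * n) ^ (n - 2) * (4 * n) ^ (n - 2) * ((n - 1) * (4 * n) - (1 + 4 * n))) := by
    rw [hobs, spiralOffset_last (by omega) heven, hpow]
    linear_combination ((4 * n : ℝ) ^ (n - 2) * (4 * n) ^ (n - 2) *
      (-(n - 1) * (4 * n) + (1 + 4 * n))) * spiralSign_sq (n - 2)
  rw [e]
  have : (0 : ℝ) < (n - 1) * (4 * n) - (1 + 4 * n) := by nlinarith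
  have : (0 : ℝ) < (4 * n) ^ (n - 2) := by positivity
  have := mul_pos (mul_pos this this) ‹(0 : ℝ) < (n - 1) * (4 * n) - (1 + 4 * n)›
  linarith

lemma spiralOffset_second_pos {n : ℕ} (hn : 6 ≤ n) : 0 < spiralOffset n 0 1 (spiralObstacle n 1) := by
  have hn' : (6 : ℝ) ≤ n := by exact_mod_cast hn
  have hobs : spiralObstacle n 1 = -(4 * n) := rfl
  rw [spiralOffset_zero_one, hobs]
  nlinarith

lemma spiralOffset_second_neg {n i : ℕ} (hn : 6 ≤ n) (hi : 1 ≤ i) (hs : spiralSign i = -1) :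
    spiralOffset n i (i + 2) (spiralObstacle n 1) < 0 := by
  have hn' : (6 : ℝ) ≤ n := by exact_mod_cast hn
  have hK : (1 : ℝ) < 4 * n := by linarith
  have hK0 : (0 : ℝ) < 4 * n := by linarith
  have hobs : spiralObstacle n 1 = -(4 * n) := rfl
  have h1 : (4 * n : ℝ) ^ 1 ≤ (4 * n) ^ i := pow_le_pow_right₀ hK.le hi
  have e : spiralOffset n i (i + 2) (spiralObstacle n 1) =
      -((4 * n) ^ i * (4 * n) * (2 * (4 * n) ^ i * (4 * n) - (1 + (4 * n) ^ 2))) := by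
    rw [spiralOffset_add_two, hobs, hs]; ring
  rw [e]
  have pi : (0 : ℝ) < (4 * n) ^ i := by positivity
  have : 0 < 2 * (4 * n : ℝ) ^ i * (4 * n) - (1 + (4 * n) ^ 2) := by nlinarith
  have := mul_pos (mul_pos pi hK0) this
  linarith

/-- No edge of the spiral meets an obstacle on the axis. -/
lemma spiralOffset_ne_zero {n a b : ℕ} (hn : 6 ≤ n) (heven : Even n) (h : IsSpiralEdge n a b)
    (i : Fin 3) : spiralOffset n a b (spiralObstacle n i) ≠ 0 := by
  have hn' : (6 : ℝ) ≤ n := by exact_mod_cast hn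
  have hK : (1 : ℝ) < 4 * n := by linarith
  have hK0 : (0 : ℝ) < 4 * n := by linarith
  have hs0 : ∀ j, spiralSign j ≠ 0 := fun j => by
    rcases spiralSign_cases j with e | e <;> rw [e] <;> norm_num
  have hlt : (4 * n : ℝ) ^ (n - 1) ≠ 0 := by positivity
  have hn1 : (n : ℝ) - 1 ≠ 0 := by linarith
  fin_cases i
  · show spiralOffset n a b 0 ≠ 0
    rcases h with ⟨rfl, rfl⟩ | ⟨rfl, hb⟩ | ⟨h1, h2⟩
    · rw [spiralOffset_zero_one]; nlinarith
    · rw [spiralOffset_add_two, zero_mul, sub_zero]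
      exact mul_ne_zero (mul_ne_zero two_ne_zero (hs0 _)) (by positivity)
    · obtain rfl : a = n - 2 := by omega
      obtain rfl : b = n - 1 := by omega
      rw [spiralOffset_last (by omega) heven, zero_mul, sub_zero]
      exact mul_ne_zero (by positivity) (neg_ne_zero.2 (mul_ne_zero (mul_ne_zero (hs0 _) hn1) hlt))
  · show spiralOffset n a b (spiralObstacle n 1) ≠ 0
    rcases h with ⟨rfl, rfl⟩ | ⟨rfl, hb⟩ | ⟨h1, h2⟩
    · exact (spiralOffset_second_pos hn).ne'
    · rcases spiralSign_cases a with e | e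
      · have hobs : spiralObstacle n 1 = -(4 * n) := rfl
        rw [spiralOffset_add_two, hobs, e]
        apply ne_of_gt
        have : (0 : ℝ) < (4 * n) ^ a := by positivity
        have : (0 : ℝ) < (4 * n) ^ (a + 2) := by positivity
        rw [neg_mul, sub_neg_eq_add]
        positivity
      · have ha : 1 ≤ a := by
          by_contra ha
          obtain rfl : a = 0 := by omega
          rw [spiralSign_zero] at e
          norm_num at e
        exact (spiralOffset_second_neg hn ha e).ne
    · obtain rfl : a = n - 2 := by omega
      obtain rfl : b = n - 1 := by omega
      have hobs : spiralObstacle n 1 = -(4 * n) := rfl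
      rw [spiralOffset_last (by omega) heven, hobs]
      refine mul_ne_zero (by positivity) ?_
      have h1 : (4 * n : ℝ) ^ 2 ≤ (4 * n) ^ (n - 1) := pow_le_pow_right₀ hK.le (by omega)
      have h2 : (4 * n : ℝ) ^ 2 * 5 ≤ (4 * n) ^ (n - 1) * (n - 1) :=
        mul_le_mul h1 (by linarith) (by norm_num) (by positivity)
      rcases spiralSign_cases (n - 2) with e | e <;> rw [e]
      · apply ne_of_lt; nlinarith
      · apply ne_of_gt; nlinarith
  · show spiralOffset n a b (spiralObstacle n 2) ≠ 0
    by_cases hl : a + 2 ≠ n ∨ b + 1 ≠ n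
    · exact fun h0 => by simpa [h0] using spiralOffset_third_pos hn heven h hl
    · obtain rfl : a = n - 2 := by omega
      obtain rfl : b = n - 1 := by omega
      exact fun h0 => by simpa [h0] using spiralOffset_third_neg hn heven

/-- At every point of the spiral the two incident edges are separated by an obstacle. -/
lemma exists_spiralObstacle_separating {n j : ℕ} (hn : 6 ≤ n) (heven : Even n) (hj : j < n) :
    ∃ a b, a < n ∧ b < n ∧ (IsSpiralEdge n a j ∨ IsSpiralEdge n j a) ∧
      (IsSpiralEdge n b j ∨ IsSpiralEdge n j b) ∧
      ∃ i, spiralOffset n a j (spiralObstacle n i) * spiralOffset n b j (spiralObstacle n i) < 0 := by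
  have hn' : (6 : ℝ) ≤ n := by exact_mod_cast hn
  have hK0 : (0 : ℝ) < 4 * n := by linarith
  have h0 : spiralObstacle n 0 = 0 := rfl
  have hthird : ∀ x y : ℝ, 0 < spiralSign (n - 2) * x → spiralSign (n - 2) * y < 0 → x * y < 0 := by
    intro x y hx hy
    have := mul_neg_of_pos_of_neg hx hy
    have e : spiralSign (n - 2) * x * (spiralSign (n - 2) * y) = x * y := by
      linear_combination x * y * spiralSign_sq (n - 2)
    rwa [e] at this
  by_cases hj0 : j = 0
  · subst hj0
    refine ⟨1, 2, by omega, by omega, Or.inr (Or.inl ⟨rfl, rfl⟩),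
      Or.inr (Or.inr (Or.inl ⟨rfl, by omega⟩)), 0, ?_⟩
    rw [spiralOffset_comm n 1, spiralOffset_comm n 2, spiralOffset_add_two n 0,
      spiralOffset_zero_one, spiralSign_zero, h0]
    apply mul_neg_of_neg_of_pos
    · nlinarith
    · rw [zero_mul, sub_zero]; positivity
  -- Both edges at point 1 cross left of the origin, at about `-(n - 1)` and `-8 * n`; the second
  -- obstacle at `-4 * n` lies between.
  by_cases hj1 : j = 1
  · subst hj1
    refine ⟨0, 3, by omega, by omega, Or.inl (Or.inl ⟨rfl, rfl⟩),
      Or.inr (Or.inr (Or.inl ⟨rfl, by omega⟩)), 1, ?_⟩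
    rw [spiralOffset_comm n 3]
    exact mul_neg_of_pos_of_neg (spiralOffset_second_pos hn)
      (spiralOffset_second_neg hn le_rfl (by
        rw [spiralSign_succ_of_even Even.zero, spiralSign_zero]))
  by_cases hj2 : j + 2 < n
  · obtain ⟨i, rfl⟩ : ∃ i, j = i + 2 := ⟨j - 2, by omega⟩
    refine ⟨i, i + 2 + 2, by omega, by omega, Or.inl (Or.inr (Or.inl ⟨rfl, by omega⟩)),
      Or.inr (Or.inr (Or.inl ⟨rfl, by omega⟩)), 0, ?_⟩
    rw [spiralOffset_comm n (i + 2 + 2), spiralOffset_add_two, spiralOffset_add_two,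
      spiralSign_add_two, h0]
    have p0 : (0 : ℝ) < (4 * n) ^ i * (4 * n) ^ (i + 2) := by positivity
    have p1 : (0 : ℝ) < (4 * n) ^ (i + 2) * (4 * n) ^ (i + 2 + 2) := by positivity
    have := mul_pos p0 p1
    have e : (2 * spiralSign i * ((4 * n) ^ i * (4 * n) ^ (i + 2)) -
        0 * ((4 * n) ^ i + (4 * n) ^ (i + 2))) *
        (2 * -spiralSign i * ((4 * n) ^ (i + 2) * (4 * n) ^ (i + 2 + 2)) -
        0 * ((4 * n) ^ (i + 2) + (4 * n) ^ (i + 2 + 2))) =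
        -4 * ((4 * n : ℝ) ^ i * (4 * n) ^ (i + 2) * ((4 * n) ^ (i + 2) * (4 * n) ^ (i + 2 + 2))) := by
      linear_combination (-4 * ((4 * n : ℝ) ^ i * (4 * n) ^ (i + 2) *
        ((4 * n) ^ (i + 2) * (4 * n) ^ (i + 2 + 2)))) * spiralSign_sq i
    rw [e]
    linarith
  -- The two outermost points are the ends of the edge that the third obstacle separates from all
  -- others.
  by_cases hj3 : j = n - 2
  · subst hj3
    refine ⟨n - 4, n - 1, by omega, by omega, Or.inl (Or.inr (Or.inl ⟨by omega, by omega⟩)),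
      Or.inr (Or.inr (Or.inr ⟨by omega, by omega⟩)), 2, ?_⟩
    rw [spiralOffset_comm n (n - 1)]
    exact hthird _ _ (spiralOffset_third_pos hn heven (Or.inr (Or.inl ⟨by omega, by omega⟩))
      (by omega)) (spiralOffset_third_neg hn heven)
  · obtain rfl : j = n - 1 := by omega
    refine ⟨n - 3, n - 2, by omega, by omega, Or.inl (Or.inr (Or.inl ⟨by omega, by omega⟩)),
      Or.inl (Or.inr (Or.inr ⟨by omega, by omega⟩)), 2, ?_⟩
    exact hthird _ _ (spiralOffset_third_pos hn heven (Or.inr (Or.inl ⟨by omega, by omega⟩))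
      (by omega)) (spiralOffset_third_neg hn heven)

/-- Seven obstacles: three on the axis and four above the spiral. -/
noncomputable def spiralObstaclePoint (n : ℕ) : Fin 3 ⊕ Fin 4 → Plane
  | Sum.inl i => !₂[spiralObstacle n i, 0]
  | Sum.inr j => !₂[(j : ℝ), (4 * n) ^ n]

lemma spiralObstaclePoint_injective {n : ℕ} (hn : 6 ≤ n) :
    Function.Injective (spiralObstaclePoint n) := by
  have hn' : (6 : ℝ) ≤ n := by exact_mod_cast hn
  have hK : (1 : ℝ) < 4 * n := by linarith
  have hp : (0 : ℝ) < (4 * n) ^ n := by positivity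
  have hobs : Function.Injective (spiralObstacle n) := by
    have h0 : spiralObstacle n 0 = 0 := rfl
    have h1 : spiralObstacle n 1 = -(4 * n) := rfl
    have h2 : spiralObstacle n 2 = -(spiralSign (n - 2) * (4 * n) ^ (n - 2)) := rfl
    have hlt : (4 * n : ℝ) ^ 1 < (4 * n) ^ (n - 2) := pow_lt_pow_right₀ hK (by omega)
    have h01 : spiralObstacle n 0 ≠ spiralObstacle n 1 := by rw [h0, h1]; intro h; linarith
    have h02 : spiralObstacle n 0 ≠ spiralObstacle n 2 := by
      rw [h0, h2]
      rcases spiralSign_cases (n - 2) with e | e <;> rw [e] <;> intro h <;> linarith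
    have h12 : spiralObstacle n 1 ≠ spiralObstacle n 2 := by
      rw [h1, h2]
      rcases spiralSign_cases (n - 2) with e | e <;> rw [e] <;> intro h <;> linarith
    intro i j h
    fin_cases i <;> fin_cases j <;> first
      | rfl
      | exact absurd h h01
      | exact absurd h h02
      | exact absurd h h12
      | exact absurd h.symm h01
      | exact absurd h.symm h02
      | exact absurd h.symm h12
  rintro (i | i) (j | j) h
  · exact congrArg Sum.inl (hobs (by simpa [spiralObstaclePoint] using congrArg (fun p : Plane => p 0) h))
  · have := congrArg (fun p : Plane => p 1) h
    simp only [spiralObstaclePoint, PiLp.toLp_apply, Matrix.cons_val_one] at this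
    exact absurd this hp.ne
  · have := congrArg (fun p : Plane => p 1) h
    simp only [spiralObstaclePoint, PiLp.toLp_apply, Matrix.cons_val_one] at this
    exact absurd this hp.ne'
  · have := congrArg (fun p : Plane => p 0) h
    simp only [spiralObstaclePoint, PiLp.toLp_apply, Matrix.cons_val_zero] at this
    exact congrArg Sum.inr (Fin.ext (by exact_mod_cast this))

/-- The set of the seven obstacles. -/
noncomputable def spiralObstacles (n : ℕ) : Finset Plane :=
  let _ := Classical.decEq Plane
  Finset.univ.image (spiralObstaclePoint n)

lemma coe_spiralObstacles (n : ℕ) :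
    (spiralObstacles n : Set Plane) = Set.range (spiralObstaclePoint n) := by
  simp [spiralObstacles]

lemma card_spiralObstacles {n : ℕ} (hn : 6 ≤ n) : (spiralObstacles n).card = 7 := by
  let _ := Classical.decEq Plane
  rw [spiralObstacles, Finset.card_image_of_injective _ (spiralObstaclePoint_injective hn)]
  simp

lemma spiralObstaclePoint_notMem_segment {n a b : ℕ} (hn : 6 ≤ n) (heven : Even n) (ha : a < n)
    (hb : b < n) (h : IsSpiralEdge n a b) (i : Fin 3 ⊕ Fin 4) :
    spiralObstaclePoint n i ∉ segment ℝ (spiralPoint n a) (spiralPoint n b) := by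
  intro hmem
  have hn' : (6 : ℝ) ≤ n := by exact_mod_cast hn
  have hK : (1 : ℝ) < 4 * n := by linarith
  rcases i with i | i
  · exact spiralOffset_ne_zero hn heven h i (crossOffset_eq_zero_of_mem (h.sign heven)
      (spiralSign_mul_pos (by omega) a) (spiralSign_mul_pos (by omega) b) hmem)
  · obtain ⟨α, β, hα, hβ, hs, -, h1⟩ := mem_segment_plane.1 hmem
    -- The four additional obstacles are higher than every vertex, hence higher than every edge.
    have hlt : ∀ j < n, spiralPoint n j 1 < (4 * n : ℝ) ^ n := by
      intro j hj
      have h1 : (4 * n : ℝ) ^ j < (4 * n) ^ n := pow_lt_pow_right₀ hK hj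
      have h2 : (0 : ℝ) < (4 * n) ^ j := by positivity
      rw [spiralPoint_one]
      rcases spiralSign_cases j with e | e <;> rw [e] <;> linarith
    simp only [spiralObstaclePoint, PiLp.toLp_apply, Matrix.cons_val_one, Matrix.cons_val_fin_one] at h1
    have ea := hlt a ha
    have eb := hlt b hb
    have : α = 1 - β := by linarith
    subst this
    rcases hβ.lt_or_eq with h | h
    · nlinarith [mul_lt_mul_of_pos_left eb h, mul_le_mul_of_nonneg_left ea.le hα]
    · rw [← h] at h1
      linarith

theorem disjoint_spiralObstacles {n : ℕ} (hn : 6 ≤ n) (heven : Even n) :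
    Disjoint (drawnSet (SimpleGraph.cycleGraph n) (spiralDrawing n)) (spiralObstacles n : Set Plane) := by
  have : NeZero n := ⟨by omega⟩
  have hedge : ∀ u v, (SimpleGraph.cycleGraph n).Adj u v → ∀ i, spiralObstaclePoint n i ∉
      segment ℝ (spiralDrawing n u) (spiralDrawing n v) := by
    intro u v huv i
    obtain ⟨x, y, -, -, h, e⟩ := exists_isSpiralEdge hn heven huv
    rw [e]
    exact spiralObstaclePoint_notMem_segment hn heven (spiralIndex_lt heven x)
      (spiralIndex_lt heven y) h i
  rw [Set.disjoint_right, coe_spiralObstacles]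
  rintro _ ⟨i, rfl⟩ (⟨u, hu⟩ | ⟨u, v, huv, h⟩)
  · apply hedge u (u + 1) ((cycleGraph_adj_iff (by omega)).2 (Or.inl rfl)) i
    rw [← hu]
    exact left_mem_segment ℝ _ _
  · exact hedge u v huv i h

/-! ### Blocking of all nontrivial shifts, and the conclusion. -/

theorem blocks_spiralDrawing {n : ℕ} [NeZero n] (hn : 6 ≤ n) (heven : Even n) {o : Fin n}
    (ho : o ≠ 0) :
    Blocks (SimpleGraph.cycleGraph n) (spiralDrawing n) (fun i => spiralDrawing n (i + o))
      (spiralObstacles n : Set Plane) := by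
  intro H
  have hn0 : 0 < n := by omega
  obtain ⟨hside, hoff⟩ := sides_preserved (fun v => spiralSign (spiralIndex v))
    (Set.range (spiralObstacle n)) (Set.finite_range _)
    (by
      rintro _ ⟨i, rfl⟩
      rw [coe_spiralObstacles]
      exact ⟨Sum.inl i, rfl⟩)
    (fun u v => sign_of_adj hn heven) (fun v => spiralSign_mul_pos hn0 _)
    (by
      intro w
      obtain ⟨a, b, ha, hb, hwa, hwb, i, hi⟩ :=
        exists_spiralObstacle_separating hn heven (spiralIndex_lt heven w)
      obtain ⟨u, rfl⟩ := exists_spiralIndex_eq heven ha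
      obtain ⟨v, rfl⟩ := exists_spiralIndex_eq heven hb
      exact ⟨u, v, _, ⟨i, rfl⟩, (adj_iff_isSpiralEdge hn heven).2 hwa,
        (adj_iff_isSpiralEdge hn heven).2 hwb, hi⟩) H
  -- Preserved sides mean that the shift preserves signs, so the offsets after the morph are again
  -- values of `spiralOffset`.
  have hsign : ∀ v, spiralSign (spiralIndex (v + o)) = spiralSign (spiralIndex v) := by
    intro v
    have h1 := hside v
    have h2 := spiralSign_mul_pos hn0 (spiralIndex (v + o))
    simp only [spiralDrawing] at h1
    rcases spiralSign_cases (spiralIndex (v + o)) with e | e <;>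
      rcases spiralSign_cases (spiralIndex v) with e' | e' <;> rw [e, e'] <;> rw [e'] at h1 <;>
      rw [e] at h2 <;> linarith
  obtain ⟨l, hl⟩ := exists_spiralIndex_eq heven (show n - 1 < n by omega)
  obtain ⟨z, hz⟩ := exists_spiralIndex_eq heven (show n - 2 < n by omega)
  have hadj : (SimpleGraph.cycleGraph n).Adj z l := by
    rw [adj_iff_isSpiralEdge hn heven, hl, hz]
    exact Or.inl (Or.inr (Or.inr ⟨by omega, by omega⟩))
  have hadj' : (SimpleGraph.cycleGraph n).Adj (z + o) (l + o) := by
    rw [cycleGraph_adj_iff (by omega)] at hadj ⊢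
    rcases hadj with h | h
    · left; rw [h]; abel
    · right; rw [h]; abel
  have hpos := hoff z l hadj _ ⟨2, rfl⟩
  have hlast := spiralOffset_third_neg hn heven
  have hneg : ∀ x y, IsSpiralEdge n x y → (x + 2 ≠ n ∨ y + 1 ≠ n) →
      ¬ 0 < spiralOffset n (n - 2) (n - 1) (spiralObstacle n 2) *
        spiralOffset n x y (spiralObstacle n 2) := by
    intro x y hxy hne hpos
    have h := mul_neg_of_neg_of_pos hlast (spiralOffset_third_pos hn heven hxy hne)
    have e : ∀ p q : ℝ, spiralSign (n - 2) * p * (spiralSign (n - 2) * q) = p * q := fun p q => by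
      linear_combination p * q * spiralSign_sq (n - 2)
    rw [e] at h
    linarith
  have hpos' : 0 < spiralOffset n (n - 2) (n - 1) (spiralObstacle n 2) *
      spiralOffset n (spiralIndex (z + o)) (spiralIndex (l + o)) (spiralObstacle n 2) := by
    unfold spiralOffset
    rw [hsign z, hsign l, ← hz, ← hl]
    exact hpos
  -- The image of the outermost edge `zl` must be `zl` itself. Kept orientation gives `o = 0`;
  -- reversed orientation would give `z` and `l` equal signs.
  rcases (adj_iff_isSpiralEdge hn heven).1 hadj' with h | h
  · refine hneg _ _ h ?_ hpos'
    left
    intro h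
    have : spiralIndex (z + o) = spiralIndex z := by omega
    have := spiralIndex_injective heven this
    exact ho (by simpa using this)
  · rw [spiralOffset_comm n (spiralIndex (z + o))] at hpos'
    refine hneg _ _ h ?_ hpos'
    right
    intro h
    have e : spiralIndex (z + o) = spiralIndex l := by omega
    have e1 := hsign z
    rw [e] at e1
    have e2 := sign_of_adj hn heven hadj
    rw [e1] at e2
    rcases spiralSign_cases (spiralIndex z) with e | e <;> rw [e] at e2 <;> norm_num at e2

theorem proposition2 (n : ℕ) (hn : 6 ≤ n) (heven : Even n) :
    ∃ Γ : Fin n → Plane, IsDrawing (SimpleGraph.cycleGraph n) Γ ∧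
      ∀ Γ' : Fin n → Plane, IsShiftedVersion Γ Γ' →
        ∃ P : Finset Plane, P.card = 7 ∧
          Compatible (SimpleGraph.cycleGraph n) Γ Γ' (P : Set Plane) ∧
          Blocks (SimpleGraph.cycleGraph n) Γ Γ' (P : Set Plane) := by
  have : NeZero n := ⟨by omega⟩
  have hΓ := isDrawing_spiralDrawing hn heven
  refine ⟨spiralDrawing n, hΓ, fun Γ' hΓ' => ?_⟩
  obtain ⟨o, ho, rfl⟩ := hΓ'.exists_shift (by omega) (signedArea_spiralDrawing_neg hn heven).ne
  exact ⟨spiralObstacles n, card_spiralObstacles hn,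
    compatible_shift (by omega) hΓ (disjoint_spiralObstacles hn heven) o,
    blocks_spiralDrawing hn heven ho⟩
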